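/- Theorem (Sharp threshold for $\ell^q$ discrepancy). For a real matrix $A\in\mathbb{R}^{N\times N}$ and $q\in[2,\infty]$, let \[ \mathrm{disc}_q(A) := \min_{\sigma\in\{-1,+1\}^N}\|A\sigma\|_q \] denote its $\ell^q$ discrepancy, where $\|x\|_q=(\sum_i|x_i|^q)^{1/q}$ for $q<\infty$ and $\|x\|_\infty=\max_i|x_i|$. There is a universal constant $c>0$ such that the following holds for every integer $N\ge 1$ and every $q\in[2,\infty]$ (with $1/\infty:=0$). Let $A$ be an $N\times N$ random matrix with independent standard normal entries. Then $\mathrm{disc}_q(A)$ has finite second moment and strictly positive variance, and \[ \frac{\mathbb{E}[\mathrm{disc}_q(A)]}{\sqrt{\mathrm{Var}(\mathrm{disc}_q(A))}} \;\ge\; c\,N^{1/q}\sqrt{1+\Big(\tfrac12-\tfrac1q\Big)\log N}. \] -/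

import Mathlib

open MeasureTheory ProbabilityTheory
open scoped ENNReal Matrix

noncomputable section

/-- The finite set `{-1, +1}^n` of sign vectors. -/
def signVectors (n : ℕ) : Finset (Fin n → ℝ) :=
  Fintype.piFinset fun _ => ({-1, 1} : Finset ℝ)

theorem signVectors_nonempty (n : ℕ) : (signVectors n).Nonempty :=
  ⟨fun _ => 1, by simp [signVectors]⟩

/-- The `ℓ^q` discrepancy `min_{σ ∈ {-1, +1}^n} ‖A σ‖_q` of a real `m × n` matrix `A`. The norm is
that of `PiLp q`: `(∑ i, |x i| ^ q) ^ (1 / q)` for finite `q`, and `max_i |x i|` for `q = ∞`. -/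
def lqDisc {m n : ℕ} (q : ℝ≥0∞) (A : Matrix (Fin m) (Fin n) ℝ) : ℝ :=
  (signVectors n).inf' (signVectors_nonempty n)
    fun σ => ‖(WithLp.toLp q (A *ᵥ σ) : PiLp q fun _ : Fin m => ℝ)‖

/-- The entries of the random matrix `A` are independent standard normal random variables. -/
def IsGaussianMatrix {Ω : Type*} [MeasurableSpace Ω] {m n : ℕ}
    (A : Ω → Matrix (Fin m) (Fin n) ℝ) (μ : Measure Ω) : Prop :=
  iIndepFun (fun (p : Fin m × Fin n) (ω : Ω) => A ω p.1 p.2) μ ∧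
    ∀ (i : Fin m) (j : Fin n), HasLaw (fun ω => A ω i j) (gaussianReal 0 1) μ

end

open scoped BigOperators
open Filter Topology

/-! The mean is at least of order `N^(1/q + 1/2)` and the variance at most of order `N / (1 + (1/2 -
1/q) log N)`; the quotient gives the theorem.

Mean (`le_integral_lqDisc`): by Hölder the `ℓ^q` norm is at least `N^(1/q - 1)` times the `ℓ^1`
norm. For fixed `σ`, `Aσ/√N` is a standard Gaussian vector, and the Laplace transform of its `ℓ^1`
norm at `l` is at most `l^(-N)`. This is small enough to sum over all `2^N` sign vectors.

Variance (`variance_lqDisc_le`): the logarithmic gain is Talagrand's `L¹`-`L²` phenomenon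
(`expect_sq_sub_sq_expect_le`), proved on the discrete cube from hypercontractivity. Each Gaussian
entry is replaced by a normalized sum of `m` signs. At an optimal `σ`, the influence of an entry in
row `i` is controlled by `r_i^(p-1)` with `∑ r_i^p = 1`. Summed over the rows, these weights are at
most `N^(1/p)` and their squares at most `1`. Row exchangeability spreads both bounds evenly, so the
`L¹` bound is smaller than the `L²` bound by the factor `N^(1/p - 1/2)`, whose logarithm enters the
variance bound. The central limit theorem (`m → ∞`) and dominated convergence carry the bound to
Gaussian matrices and to every `q`, including `∞`. -/

/-! ### The two-point inequality -/

theorem two_mul_le_rpow_add_sub_rpow_sub {t x : ℝ} (ht0 : 0 ≤ t) (ht1 : t ≤ 1) (hx0 : 0 ≤ x)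
    (hx1 : x ≤ 1) : 2 * t * x ≤ (1 + x) ^ t - (1 - x) ^ t := by
  rcases ht0.eq_or_lt with rfl | ht
  · simp
  have hmono : MonotoneOn (fun x : ℝ => (1 + x) ^ t - (1 - x) ^ t - 2 * t * x)
      (Set.Icc 0 1) := by
    apply monotoneOn_of_deriv_nonneg (convex_Icc 0 1)
    · refine ContinuousOn.sub (ContinuousOn.sub ?_ ?_) (by fun_prop)
      · exact ContinuousOn.rpow_const (by fun_prop) fun x _ => Or.inr ht0
      · exact ContinuousOn.rpow_const (by fun_prop) fun x _ => Or.inr ht0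
    · intro y hy
      rw [interior_Icc] at hy
      have h1 : (1 + y) ≠ 0 := by linarith [hy.1]
      have h2 : (1 - y) ≠ 0 := by linarith [hy.2]
      refine DifferentiableAt.differentiableWithinAt ?_
      refine DifferentiableAt.sub (DifferentiableAt.sub ?_ ?_) (by fun_prop)
      · exact DifferentiableAt.rpow_const (by fun_prop) (Or.inl h1)
      · exact DifferentiableAt.rpow_const (by fun_prop) (Or.inl h2)
    · intro y hy
      rw [interior_Icc] at hy
      have h1 : 0 < 1 + y := by linarith [hy.1]
      have h2 : 0 < 1 - y := by linarith [hy.2]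
      have hd : HasDerivAt (fun x : ℝ => (1 + x) ^ t - (1 - x) ^ t - 2 * t * x)
          (1 * t * (1 + y) ^ (t - 1) - (-1) * t * (1 - y) ^ (t - 1) - 2 * t * 1) y := by
        refine HasDerivAt.sub (HasDerivAt.sub ?_ ?_) ((hasDerivAt_id y).const_mul _)
        · exact ((hasDerivAt_id y).const_add 1).rpow_const (Or.inl h1.ne')
        · exact ((hasDerivAt_id y).const_sub 1).rpow_const (Or.inl h2.ne')
      rw [hd.deriv]
      have ha : 0 < (1 + y) ^ (t - 1) := Real.rpow_pos_of_pos h1 _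
      have hb : 0 < (1 - y) ^ (t - 1) := Real.rpow_pos_of_pos h2 _
      -- The product is `(1 - y²)^(t-1)` with a nonpositive exponent; by AM-GM the sum of the
      -- factors is then at least `2`.
      have hab : 1 ≤ (1 + y) ^ (t - 1) * (1 - y) ^ (t - 1) := by
        rw [← Real.mul_rpow h1.le h2.le]
        apply Real.one_le_rpow_of_pos_of_le_one_of_nonpos
        · positivity
        · nlinarith [hy.1]
        · linarith
      have : 2 ≤ (1 + y) ^ (t - 1) + (1 - y) ^ (t - 1) := by
        nlinarith [sq_nonneg ((1 + y) ^ (t - 1) - (1 - y) ^ (t - 1))]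
      nlinarith
  have := hmono (Set.left_mem_Icc.2 zero_le_one) ⟨hx0, hx1⟩ hx0
  simp at this
  linarith

theorem one_add_mul_sq_le_rpow_add_rpow {t x : ℝ} (ht0 : 0 ≤ t) (ht1 : t ≤ 1) (hx0 : 0 ≤ x)
    (hx1 : x ≤ 1) :
    1 + (1 + t) * t / 2 * x ^ 2 ≤ ((1 + x) ^ (1 + t) + (1 - x) ^ (1 + t)) / 2 := by
  have hmono : MonotoneOn
      (fun x : ℝ => ((1 + x) ^ (1 + t) + (1 - x) ^ (1 + t)) / 2 - (1 + t) * t / 2 * x ^ 2)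
      (Set.Icc 0 1) := by
    have hd (y : ℝ) : HasDerivAt
        (fun x : ℝ => ((1 + x) ^ (1 + t) + (1 - x) ^ (1 + t)) / 2 - (1 + t) * t / 2 * x ^ 2)
        ((1 * (1 + t) * (1 + y) ^ (1 + t - 1) + (-1) * (1 + t) * (1 - y) ^ (1 + t - 1)) / 2
          - (1 + t) * t / 2 * ((2 : ℕ) * y ^ (2 - 1) * 1)) y := by
      refine HasDerivAt.sub (HasDerivAt.div_const (HasDerivAt.add ?_ ?_) _)
        (((hasDerivAt_id y).pow 2).const_mul _)
      · exact ((hasDerivAt_id y).const_add 1).rpow_const (Or.inr (by linarith))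
      · exact ((hasDerivAt_id y).const_sub 1).rpow_const (Or.inr (by linarith))
    apply monotoneOn_of_deriv_nonneg (convex_Icc 0 1)
    · exact fun y _ => (hd y).continuousAt.continuousWithinAt
    · exact fun y _ => (hd y).differentiableAt.differentiableWithinAt
    · intro y hy
      rw [interior_Icc] at hy
      rw [(hd y).deriv]
      have := two_mul_le_rpow_add_sub_rpow_sub ht0 ht1 hy.1.le hy.2.le
      have e : 1 + t - 1 = t := by ring
      rw [e]
      push_cast
      norm_num
      nlinarith
  have := hmono (Set.left_mem_Icc.2 zero_le_one) ⟨hx0, hx1⟩ hx0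
  simp at this
  linarith

/-- Bonami's inequality `‖T_{√t} f‖₂ ≤ ‖f‖_{1+t}` for the nonnegative function with values `m ± d`.
After scaling to `m = 1`, Bernoulli's inequality bounds the left side by the second-order lower
bound for the right side. -/
theorem sq_add_mul_sq_le_rpow {t m d : ℝ} (ht0 : 0 ≤ t) (ht1 : t ≤ 1) (hd : |d| ≤ m) :
    √(m ^ 2 + t * d ^ 2) ≤ (((m + d) ^ (1 + t) + (m - d) ^ (1 + t)) / 2) ^ (1 / (1 + t)) := by
  wlog hd0 : 0 ≤ d generalizing d
  · have := this (d := -d) (by simpa using hd) (by linarith)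
    simpa [← sub_eq_add_neg, add_comm] using this
  rw [abs_of_nonneg hd0] at hd
  rcases (hd0.trans hd).eq_or_lt with hm | hm
  · have : d = 0 := by linarith
    subst this
    simp [← hm]
    positivity
  have hp : 0 < 1 + t := by linarith
  set x := d / m with hx
  have hdx : d = m * x := by rw [hx]; field_simp
  have hx0 : 0 ≤ x := by positivity
  have hx1 : x ≤ 1 := (div_le_one hm).2 hd
  have key : (1 + t * x ^ 2) ^ ((1 + t) / 2) ≤ ((1 + x) ^ (1 + t) + (1 - x) ^ (1 + t)) / 2 := by
    refine le_trans ?_ (one_add_mul_sq_le_rpow_add_rpow ht0 ht1 hx0 hx1)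
    refine (rpow_one_add_le_one_add_mul_self (by nlinarith [sq_nonneg x]) (by linarith)
      (by linarith)).trans (by nlinarith)
  have e1 : ((m + d) ^ (1 + t) + (m - d) ^ (1 + t)) / 2
      = m ^ (1 + t) * (((1 + x) ^ (1 + t) + (1 - x) ^ (1 + t)) / 2) := by
    rw [show m + d = m * (1 + x) by rw [hdx]; ring, show m - d = m * (1 - x) by rw [hdx]; ring,
      Real.mul_rpow hm.le (by linarith), Real.mul_rpow hm.le (by linarith)]
    ring
  have e2 : m ^ 2 + t * d ^ 2 = m ^ 2 * (1 + t * x ^ 2) := by rw [hdx]; ring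
  have h1 : 0 ≤ 1 + t * x ^ 2 := by positivity
  have h2 : 0 ≤ ((1 + x) ^ (1 + t) + (1 - x) ^ (1 + t)) / 2 := le_trans (by positivity) key
  rw [e1, e2, Real.mul_rpow (by positivity) h2, ← Real.rpow_mul hm.le,
    mul_one_div_cancel hp.ne', Real.rpow_one, Real.sqrt_mul (by positivity), Real.sqrt_sq hm.le]
  refine mul_le_mul_of_nonneg_left ?_ hm.le
  refine le_trans (le_of_eq ?_) (Real.rpow_le_rpow (by positivity) key (by positivity))
  rw [← Real.rpow_mul h1, Real.sqrt_eq_rpow]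
  congr 1
  field_simp

/-! ### Hypercontractivity on the discrete cube -/

/-- The sign `±1` of a bit. -/
def bitSign (b : Bool) : ℝ := cond b 1 (-1)

/-- The density of a pair of `t`-correlated uniform points of the cube `ι → Bool`. -/
def cubeKernel {ι : Type*} [Fintype ι] (t : ℝ) (a b : ι → Bool) : ℝ :=
  ∏ i, (1 + t * (bitSign (a i) * bitSign (b i)))

theorem cubeKernel_nonneg {ι : Type*} [Fintype ι] {t : ℝ} (ht0 : 0 ≤ t) (ht1 : t ≤ 1)
    (a b : ι → Bool) : 0 ≤ cubeKernel t a b := by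
  refine Finset.prod_nonneg fun i _ => ?_
  rcases a i <;> rcases b i <;> simp [bitSign] <;> linarith

theorem expect_bool (f : Bool → ℝ) : (𝔼 b, f b) = (f true + f false) / 2 := by
  rw [Fintype.expect_eq_sum_div_card]
  simp

/-- The two-function hypercontractive inequality for a density `κ` on a finite probability space. -/
def IsHypercontractive {α : Type*} [Fintype α] (κ : α → α → ℝ) (p : ℝ) : Prop :=
  ∀ u v : α → ℝ, (∀ a, 0 ≤ u a) → (∀ a, 0 ≤ v a) →
    (𝔼 a, 𝔼 b, κ a b * (u a * v b)) ≤ (𝔼 a, u a ^ p) ^ (1 / p) * (𝔼 a, v a ^ p) ^ (1 / p)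

/-- With means `m` and half-differences `d`, the left side is `m_u m_v + t d_u d_v`. Cauchy–Schwarz
splits it into two factors, each bounded by the two-point inequality. -/
theorem isHypercontractive_bool {t : ℝ} (ht0 : 0 ≤ t) (ht1 : t ≤ 1) :
    IsHypercontractive (fun a b : Bool => 1 + t * (bitSign a * bitSign b)) (1 + t) := by
  intro u v hu hv
  have key (w : Bool → ℝ) (hw : ∀ a, 0 ≤ w a) :
      √(((w true + w false) / 2) ^ 2 + t * ((w true - w false) / 2) ^ 2)
        ≤ (𝔼 a, w a ^ (1 + t)) ^ (1 / (1 + t)) := by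
    have h := sq_add_mul_sq_le_rpow (m := (w true + w false) / 2) (d := (w true - w false) / 2)
      ht0 ht1 (by rw [abs_le]; constructor <;> linarith [hw true, hw false])
    rw [expect_bool]
    convert h using 6 <;> ring
  refine le_trans ?_ (mul_le_mul (key u hu) (key v hv) (Real.sqrt_nonneg _)
    ((Real.sqrt_nonneg _).trans (key u hu)))
  rw [← Real.sqrt_mul (by positivity)]
  apply Real.le_sqrt_of_sq_le
  simp only [expect_bool, bitSign, cond_true, cond_false]
  nlinarith [mul_nonneg ht0 (sq_nonneg ((u true + u false) * (v true - v false) -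
    (v true + v false) * (u true - u false)))]

/-- Tensorization: the inequality for `l` is applied on fibres, weighted by `κ ≥ 0`, and then the
inequality for `κ` is applied to the fibre norms. -/
theorem IsHypercontractive.prod {α β : Type*} [Fintype α] [Fintype β] {κ : α → α → ℝ}
    {l : β → β → ℝ} {p : ℝ} (hp : 0 < p) (hκ : IsHypercontractive κ p)
    (hl : IsHypercontractive l p) (hκ0 : ∀ a b, 0 ≤ κ a b) :
    IsHypercontractive (fun x y : α × β => κ x.1 y.1 * l x.2 y.2) p := by
  intro u v hu hv
  have norm_eq (w : α × β → ℝ) (hw : ∀ a, 0 ≤ w a) :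
      (𝔼 x, w x ^ p) = 𝔼 a, ((𝔼 b, w (a, b) ^ p) ^ (1 / p)) ^ p := by
    rw [← Finset.univ_product_univ, Finset.expect_product]
    refine Finset.expect_congr rfl fun a _ => ?_
    rw [← Real.rpow_mul (Finset.expect_nonneg fun b _ => Real.rpow_nonneg (hw _) _),
      one_div_mul_cancel hp.ne', Real.rpow_one]
  rw [norm_eq u hu, norm_eq v hv]
  refine le_trans ?_ (hκ (fun a => (𝔼 b, u (a, b) ^ p) ^ (1 / p))
    (fun a => (𝔼 b, v (a, b) ^ p) ^ (1 / p))
    (fun a => Real.rpow_nonneg (Finset.expect_nonneg fun b _ => Real.rpow_nonneg (hu _) _) _)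
    (fun a => Real.rpow_nonneg (Finset.expect_nonneg fun b _ => Real.rpow_nonneg (hv _) _) _))
  simp only [← Finset.univ_product_univ, Finset.expect_product]
  refine Finset.expect_le_expect fun a _ => ?_
  rw [Finset.expect_comm]
  refine Finset.expect_le_expect fun a' _ => ?_
  refine le_trans (le_of_eq ?_) (mul_le_mul_of_nonneg_left
    (hl (fun b => u (a, b)) (fun b => v (a', b)) (fun b => hu _) (fun b => hv _)) (hκ0 a a'))
  simp only [Finset.mul_expect, mul_assoc]

theorem IsHypercontractive.of_equiv {α β : Type*} [Fintype α] [Fintype β] {κ : α → α → ℝ}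
    {l : β → β → ℝ} {p : ℝ} (e : α ≃ β) (h : ∀ a b, κ a b = l (e a) (e b))
    (hκ : IsHypercontractive κ p) : IsHypercontractive l p := by
  intro u v hu hv
  have := hκ (u ∘ e) (v ∘ e) (fun a => hu _) (fun a => hv _)
  rw [Fintype.expect_equiv e (fun a => (u ∘ e) a ^ p) (fun a => u a ^ p) (fun _ => rfl),
    Fintype.expect_equiv e (fun a => (v ∘ e) a ^ p) (fun a => v a ^ p) (fun _ => rfl)] at this
  refine le_trans (le_of_eq ?_) this
  symm
  refine Fintype.expect_equiv e _ _ fun a => Fintype.expect_equiv e _ _ fun b => ?_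
  rw [h]; rfl

theorem isHypercontractive_fin {t : ℝ} (ht0 : 0 ≤ t) (ht1 : t ≤ 1) (n : ℕ) :
    IsHypercontractive (fun a b : Fin n → Bool => cubeKernel t a b) (1 + t) := by
  induction n with
  | zero =>
    intro u v hu hv
    have hp : 1 + t ≠ 0 := by linarith
    simp [cubeKernel, ← Real.rpow_mul (hu _), ← Real.rpow_mul (hv _), hp]
  | succ n ih =>
    refine IsHypercontractive.of_equiv (Fin.consEquiv fun _ : Fin (n + 1) => Bool) ?_
      ((isHypercontractive_bool ht0 ht1).prod (by linarith) ih ?_)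
    · rintro ⟨a, x⟩ ⟨b, y⟩
      simp [cubeKernel, Fin.prod_univ_succ, Fin.consEquiv]
    · intro a b
      rcases a <;> rcases b <;> simp [bitSign] <;> linarith

theorem isHypercontractive_cubeKernel {ι : Type*} [Fintype ι] [DecidableEq ι] {t : ℝ}
    (ht0 : 0 ≤ t) (ht1 : t ≤ 1) :
    IsHypercontractive (fun a b : ι → Bool => cubeKernel t a b) (1 + t) := by
  refine IsHypercontractive.of_equiv (Equiv.arrowCongr (Fintype.equivFin ι).symm (Equiv.refl Bool))
    ?_ (isHypercontractive_fin ht0 ht1 (Fintype.card ι))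
  intro a b
  unfold cubeKernel
  exact Fintype.prod_equiv (Fintype.equivFin ι).symm _ _ fun i => by simp

/-! ### Noise correlation and the `L¹`-`L²` inequality -/

section cube

variable {ι : Type*} [DecidableEq ι]

/-- The point of the cube obtained from `a` by flipping the bit `e`. -/
def flipBit (e : ι) (a : ι → Bool) : ι → Bool := Function.update a e (!a e)

@[simp] theorem flipBit_same (e : ι) (a : ι → Bool) : flipBit e a e = !a e := by simp [flipBit]

@[simp] theorem flipBit_of_ne {e i : ι} (h : i ≠ e) (a : ι → Bool) : flipBit e a i = a i := by
  simp [flipBit, h]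

@[simp] theorem flipBit_flipBit (e : ι) (a : ι → Bool) : flipBit e (flipBit e a) = a := by
  funext i
  by_cases h : i = e
  · subst h; simp
  · simp [h]

@[simp] theorem bitSign_not (b : Bool) : bitSign (!b) = -bitSign b := by
  cases b <;> simp [bitSign]

theorem bitSign_mul_self (b : Bool) : bitSign b * bitSign b = 1 := by
  cases b <;> simp [bitSign]

theorem abs_bitSign (b : Bool) : |bitSign b| = 1 := by
  cases b <;> simp [bitSign]

/-- The discrete derivative of `f` in the direction of the bit `e`. -/
noncomputable def cubeDiff (e : ι) (f : (ι → Bool) → ℝ) (a : ι → Bool) : ℝ :=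
  bitSign (a e) * ((f a - f (flipBit e a)) / 2)

theorem cubeDiff_flipBit (e : ι) (f : (ι → Bool) → ℝ) (a : ι → Bool) :
    cubeDiff e f (flipBit e a) = cubeDiff e f a := by
  simp only [cubeDiff, flipBit_same, bitSign_not, flipBit_flipBit]
  ring

theorem abs_cubeDiff (e : ι) (f : (ι → Bool) → ℝ) (a : ι → Bool) :
    |cubeDiff e f a| = |f a - f (flipBit e a)| / 2 := by
  rw [cubeDiff, abs_mul, abs_bitSign, one_mul, abs_div, abs_two]

variable [Fintype ι]

theorem expect_flipBit (e : ι) (g : (ι → Bool) → ℝ) : (𝔼 a, g (flipBit e a)) = 𝔼 a, g a :=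
  Fintype.expect_equiv (Function.Involutive.toPerm (flipBit e) (flipBit_flipBit e)) _ _
    fun _ => rfl

theorem expect_eq_expect_half_add_flipBit (e : ι) (g : (ι → Bool) → ℝ) :
    (𝔼 a, g a) = 𝔼 a, (g a + g (flipBit e a)) / 2 := by
  rw [← Finset.expect_div, Finset.expect_add_distrib, expect_flipBit]
  ring

theorem hasDerivAt_cubeKernel (a b : ι → Bool) (t : ℝ) :
    HasDerivAt (fun t => cubeKernel t a b)
      (∑ e, (∏ i ∈ Finset.univ.erase e, (1 + t * (bitSign (a i) * bitSign (b i)))) *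
        (bitSign (a e) * bitSign (b e))) t := by
  have := HasDerivAt.fun_finsetProd (u := Finset.univ)
    (f := fun i t => 1 + t * (bitSign (a i) * bitSign (b i)))
    (f' := fun i => bitSign (a i) * bitSign (b i)) (x := t)
    (fun i _ => by simpa using ((hasDerivAt_id t).mul_const _).const_add 1)
  simpa [cubeKernel] using this

/-- Averaging over the bit `e` in both variables turns `bitSign (a e) * f a` into `cubeDiff e f a`.
Since `cubeDiff e f` ignores that bit, the `e`-th factor of the kernel averages to `1` on the right.
-/
theorem expect_prod_erase_mul_eq (e : ι) (f : (ι → Bool) → ℝ) (t : ℝ) :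
    (𝔼 a, 𝔼 b, (∏ i ∈ Finset.univ.erase e, (1 + t * (bitSign (a i) * bitSign (b i)))) *
        (bitSign (a e) * bitSign (b e)) * (f a * f b)) =
      𝔼 a, 𝔼 b, cubeKernel t a b * (cubeDiff e f a * cubeDiff e f b) := by
  set W : (ι → Bool) → (ι → Bool) → ℝ := fun a b =>
    ∏ i ∈ Finset.univ.erase e, (1 + t * (bitSign (a i) * bitSign (b i))) with hW
  have hWa (a b) : W (flipBit e a) b = W a b := by
    refine Finset.prod_congr rfl fun i hi => ?_
    rw [flipBit_of_ne (Finset.ne_of_mem_erase hi)]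
  have hWb (a b) : W a (flipBit e b) = W a b := by
    refine Finset.prod_congr rfl fun i hi => ?_
    rw [flipBit_of_ne (Finset.ne_of_mem_erase hi)]
  have hK (a b) : cubeKernel t a b = W a b * (1 + t * (bitSign (a e) * bitSign (b e))) := by
    rw [cubeKernel, hW, Finset.prod_erase_mul _ _ (Finset.mem_univ e)]
  have lhs : (𝔼 a, 𝔼 b, W a b * (bitSign (a e) * bitSign (b e)) * (f a * f b)) =
      𝔼 a, 𝔼 b, W a b * (cubeDiff e f a * cubeDiff e f b) := by
    rw [expect_eq_expect_half_add_flipBit e]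
    refine Finset.expect_congr rfl fun a _ => ?_
    rw [← Finset.expect_add_distrib, Finset.expect_div, expect_eq_expect_half_add_flipBit e]
    refine Finset.expect_congr rfl fun b _ => ?_
    simp only [hWa, hWb, flipBit_same, bitSign_not, cubeDiff]
    ring
  have rhs : (𝔼 a, 𝔼 b, cubeKernel t a b * (cubeDiff e f a * cubeDiff e f b)) =
      𝔼 a, 𝔼 b, W a b * (cubeDiff e f a * cubeDiff e f b) := by
    rw [expect_eq_expect_half_add_flipBit e]
    refine Finset.expect_congr rfl fun a _ => ?_
    rw [← Finset.expect_add_distrib, Finset.expect_div]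
    refine Finset.expect_congr rfl fun b _ => ?_
    simp only [hK, hWa, flipBit_same, bitSign_not, cubeDiff_flipBit]
    ring
  rw [lhs, rhs]

/-- The correlation of `f` with its noisy version. -/
noncomputable def noiseCorrelation (f : (ι → Bool) → ℝ) (t : ℝ) : ℝ :=
  𝔼 a, 𝔼 b, cubeKernel t a b * (f a * f b)

/-- Integrated over `[0, 1]`, this expresses the variance through the discrete derivatives, as the
endpoint values are the squared mean and the second moment. -/
theorem hasDerivAt_noiseCorrelation (f : (ι → Bool) → ℝ) (t : ℝ) :
    HasDerivAt (noiseCorrelation f) (∑ e, noiseCorrelation (cubeDiff e f) t) t := by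
  have h : HasDerivAt (noiseCorrelation f) (𝔼 a, 𝔼 b,
      (∑ e, (∏ i ∈ Finset.univ.erase e, (1 + t * (bitSign (a i) * bitSign (b i)))) *
        (bitSign (a e) * bitSign (b e))) * (f a * f b)) t := by
    unfold noiseCorrelation
    simp only [Fintype.expect_eq_sum_div_card]
    refine HasDerivAt.div_const (HasDerivAt.fun_sum fun a _ => ?_) _
    refine HasDerivAt.div_const (HasDerivAt.fun_sum fun b _ => ?_) _
    exact (hasDerivAt_cubeKernel a b t).mul_const _
  convert h using 1
  simp only [Finset.sum_mul, Finset.expect_sum_comm]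
  refine Finset.sum_congr rfl fun e _ => ?_
  rw [expect_prod_erase_mul_eq e f t]
  rfl

theorem noiseCorrelation_zero (f : (ι → Bool) → ℝ) : noiseCorrelation f 0 = (𝔼 a, f a) ^ 2 := by
  simp only [noiseCorrelation, cubeKernel, zero_mul, add_zero, Finset.prod_const_one, one_mul]
  rw [sq, Fintype.expect_mul_expect]

theorem noiseCorrelation_one (f : (ι → Bool) → ℝ) : noiseCorrelation f 1 = 𝔼 a, f a ^ 2 := by
  refine Finset.expect_congr rfl fun a _ => ?_
  have hK (b : ι → Bool) : cubeKernel 1 a b * (f a * f b) =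
      if a = b then (Fintype.card (ι → Bool) : ℝ) * f a ^ 2 else 0 := by
    split_ifs with h
    · subst h
      simp only [cubeKernel, bitSign_mul_self]
      norm_num
      ring
    · obtain ⟨i, hi⟩ := Function.ne_iff.1 h
      have : cubeKernel 1 a b = 0 := by
        refine Finset.prod_eq_zero (Finset.mem_univ i) ?_
        rcases h1 : a i <;> rcases h2 : b i <;> simp [bitSign] <;> simp [h1, h2] at hi
      simp [this]
  rw [Fintype.expect_eq_sum_div_card]
  simp only [hK, Finset.sum_ite_eq, Finset.mem_univ, if_true]
  field_simp

/-- Hypercontractivity bounds the correlation by the squared `L^(1+t)` norm, which is interpolated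
between `L¹` and `L²`. -/
theorem noiseCorrelation_le {h : (ι → Bool) → ℝ} {t τ L : ℝ} (ht0 : 0 ≤ t) (ht1 : t ≤ 1)
    (hτ : 0 < τ) (hL : 0 ≤ L) (h1 : (𝔼 a, |h a|) ≤ τ * Real.exp (-L))
    (h2 : (𝔼 a, h a ^ 2) ≤ τ ^ 2) :
    noiseCorrelation h t ≤ τ ^ 2 * Real.exp (-(L * (1 - t))) := by
  set A := τ * Real.exp (-L) with hA
  have hA0 : 0 < A := by positivity
  have hC0 : 0 < A ^ (1 - t) * (τ ^ 2) ^ t := by positivity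
  have hp : 0 < 1 + t := by linarith
  -- Interpolation by weighted AM-GM, normalized so that the arithmetic mean has expectation at most
  -- `1`.
  have young : (𝔼 a, |h a| ^ (1 + t)) ≤ A ^ (1 - t) * (τ ^ 2) ^ t := by
    have pt (a : ι → Bool) : |h a| ^ (1 + t) ≤
        (A ^ (1 - t) * (τ ^ 2) ^ t) * ((1 - t) * (|h a| / A) + t * (h a ^ 2 / τ ^ 2)) := by
      have := Real.geom_mean_le_arith_mean2_weighted (w₁ := 1 - t) (w₂ := t) (p₁ := |h a| / A)
        (p₂ := h a ^ 2 / τ ^ 2) (by linarith) ht0 (by positivity) (by positivity) (by ring)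
      refine le_trans (le_of_eq ?_) (mul_le_mul_of_nonneg_left this hC0.le)
      rw [Real.div_rpow (abs_nonneg _) hA0.le, Real.div_rpow (sq_nonneg _) (by positivity)]
      have e : |h a| ^ (1 + t) = |h a| ^ (1 - t) * (h a ^ 2) ^ t := by
        rw [← sq_abs (h a), ← Real.rpow_natCast, ← Real.rpow_mul (abs_nonneg _),
          ← Real.rpow_add_of_nonneg (abs_nonneg _) (by linarith) (by push_cast; linarith)]
        congr 1
        push_cast
        ring
      rw [e]
      field_simp
    refine (Finset.expect_le_expect fun a _ => pt a).trans ?_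
    rw [← Finset.mul_expect, Finset.expect_add_distrib, ← Finset.mul_expect, ← Finset.mul_expect,
      ← Finset.expect_div, ← Finset.expect_div]
    refine mul_le_of_le_one_right hC0.le ?_
    have i1 : (𝔼 a, |h a|) / A ≤ 1 := (div_le_one hA0).2 h1
    have i2 : (𝔼 a, h a ^ 2) / τ ^ 2 ≤ 1 := (div_le_one (by positivity)).2 h2
    nlinarith
  have hyp := isHypercontractive_cubeKernel (ι := ι) ht0 ht1 (fun a => |h a|) (fun a => |h a|)
    (fun a => abs_nonneg _) (fun a => abs_nonneg _)
  have hE0 : 0 ≤ 𝔼 a, |h a| ^ (1 + t) :=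
    Finset.expect_nonneg fun a _ => Real.rpow_nonneg (abs_nonneg _) _
  calc noiseCorrelation h t
      ≤ 𝔼 a, 𝔼 b, cubeKernel t a b * (|h a| * |h b|) := by
        refine Finset.expect_le_expect fun a _ => Finset.expect_le_expect fun b _ => ?_
        refine mul_le_mul_of_nonneg_left ?_ (cubeKernel_nonneg ht0 ht1 a b)
        rw [← abs_mul]
        exact le_abs_self _
    _ ≤ (𝔼 a, |h a| ^ (1 + t)) ^ (1 / (1 + t)) * (𝔼 a, |h a| ^ (1 + t)) ^ (1 / (1 + t)) := hyp
    _ = (𝔼 a, |h a| ^ (1 + t)) ^ (2 / (1 + t)) := by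
        rw [← Real.rpow_add_of_nonneg hE0 (by positivity) (by positivity)]
        congr 1
        ring
    _ ≤ (A ^ (1 - t) * (τ ^ 2) ^ t) ^ (2 / (1 + t)) :=
        Real.rpow_le_rpow hE0 young (by positivity)
    _ = τ ^ 2 * Real.exp (-(L * (1 - t)) * (2 / (1 + t))) := by
        have e : A ^ (1 - t) * (τ ^ 2) ^ t = τ ^ (1 + t) * Real.exp (-(L * (1 - t))) := by
          rw [hA, Real.mul_rpow hτ.le (Real.exp_pos _).le, ← Real.exp_mul, ← Real.rpow_natCast τ 2,
            ← Real.rpow_mul hτ.le, mul_right_comm, ← Real.rpow_add hτ]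
          congr 2
          · push_cast; ring
          · ring
        rw [e, Real.mul_rpow (by positivity) (Real.exp_pos _).le, ← Real.exp_mul,
          ← Real.rpow_mul hτ.le, mul_div_cancel₀ _ hp.ne']
        norm_num
    _ ≤ τ ^ 2 * Real.exp (-(L * (1 - t))) := by
        refine mul_le_mul_of_nonneg_left (Real.exp_le_exp.2 ?_) (by positivity)
        have i1 : 1 ≤ 2 / (1 + t) := (one_le_div hp).2 (by linarith)
        have i2 : 0 ≤ L * (1 - t) := mul_nonneg hL (by linarith)
        nlinarith

/-- The integral of `exp(-L(1-t))` over `[0, 1]` is at most both `1` and `1/L`; the factor `2/(1+L)`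
dominates the first for `L ≤ 1` and the second for `L ≥ 1`. -/
theorem sub_le_of_deriv_le_exp {φ φ' : ℝ → ℝ} {C L : ℝ} (hC : 0 ≤ C) (hL : 0 ≤ L)
    (hφ : ∀ t, HasDerivAt φ (φ' t) t)
    (h : ∀ t, 0 ≤ t → t ≤ 1 → φ' t ≤ C * Real.exp (-(L * (1 - t)))) :
    φ 1 - φ 0 ≤ C * (2 / (1 + L)) := by
  have compare {Ψ Ψ' : ℝ → ℝ} (hΨ : ∀ t, HasDerivAt Ψ (Ψ' t) t)
      (hle : ∀ t, 0 ≤ t → t ≤ 1 → φ' t ≤ Ψ' t) : φ 1 - φ 0 ≤ Ψ 1 - Ψ 0 := by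
    have hd (t) := (hΨ t).sub (hφ t)
    have hmono : MonotoneOn (Ψ - φ) (Set.Icc 0 1) := by
      apply monotoneOn_of_deriv_nonneg (convex_Icc 0 1)
      · exact fun y _ => (hd y).continuousAt.continuousWithinAt
      · exact fun y _ => (hd y).differentiableAt.differentiableWithinAt
      · intro y hy
        rw [interior_Icc] at hy
        rw [(hd y).deriv]
        linarith [hle y hy.1.le hy.2.le]
    have := hmono (Set.left_mem_Icc.2 zero_le_one) (Set.right_mem_Icc.2 zero_le_one) zero_le_one
    simp only [Pi.sub_apply] at this
    linarith
  rcases le_total L 1 with hL1 | hL1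
  · have := compare (Ψ := fun t => C * t) (Ψ' := fun _ => C * 1)
      (fun t => (hasDerivAt_id t).const_mul C) fun t h0 h1 => (h t h0 h1).trans
        (mul_le_mul_of_nonneg_left (Real.exp_le_one_iff.2
          (by nlinarith [mul_nonneg hL (sub_nonneg.2 h1)])) hC)
    refine this.trans ?_
    have : 1 ≤ 2 / (1 + L) := (one_le_div (by linarith)).2 (by linarith)
    nlinarith
  · have hL0 : 0 < L := by linarith
    have hd (t : ℝ) : HasDerivAt (fun t => C / L * Real.exp (-(L * (1 - t))))
        (C / L * (Real.exp (-(L * (1 - t))) * (-(L * (-1))))) t :=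
      ((((hasDerivAt_id t).const_sub 1).const_mul L).neg.exp).const_mul _
    have := compare hd fun t h0 h1 => (h t h0 h1).trans (le_of_eq (by field_simp))
    refine this.trans ?_
    have e0 : 0 < Real.exp (-L) := Real.exp_pos _
    have e1 : C / L ≤ C * (2 / (1 + L)) := by
      rw [div_eq_mul_one_div]
      refine mul_le_mul_of_nonneg_left ?_ hC
      rw [div_le_div_iff₀ hL0 (by linarith)]
      linarith
    have e2 : 0 ≤ C / L * Real.exp (-L) := by positivity
    simp only [sub_self, mul_zero, neg_zero, Real.exp_zero, mul_one, sub_zero]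
    linarith

/-- An `L¹`-`L²` variance bound on the discrete cube. -/
theorem expect_sq_sub_sq_expect_le (f : (ι → Bool) → ℝ) {τ L : ℝ} (hτ : 0 < τ) (hL : 0 ≤ L)
    (h1 : ∀ e, (𝔼 a, |cubeDiff e f a|) ≤ τ * Real.exp (-L))
    (h2 : ∀ e, (𝔼 a, cubeDiff e f a ^ 2) ≤ τ ^ 2) :
    (𝔼 a, f a ^ 2) - (𝔼 a, f a) ^ 2 ≤ Fintype.card ι * τ ^ 2 * (2 / (1 + L)) := by
  rw [← noiseCorrelation_one, ← noiseCorrelation_zero]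
  refine sub_le_of_deriv_le_exp (by positivity) hL (hasDerivAt_noiseCorrelation f) ?_
  intro t ht0 ht1
  refine (Finset.sum_le_sum fun e _ => noiseCorrelation_le ht0 ht1 hτ hL (h1 e) (h2 e)).trans ?_
  simp [mul_assoc]

end cube

/-! ### Discrete derivatives under symmetry and one-sided bounds -/

section cube

variable {ι : Type*} [DecidableEq ι]

theorem flipBit_comp_perm (π : Equiv.Perm ι) (e : ι) (a : ι → Bool) :
    flipBit e (a ∘ π) = flipBit (π e) a ∘ π := by
  funext i
  by_cases h : i = e
  · subst h; simp
  · simp [h]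

theorem cubeDiff_comp_perm {g : (ι → Bool) → ℝ} {π : Equiv.Perm ι} (hg : ∀ a, g (a ∘ π) = g a)
    (e : ι) (a : ι → Bool) : cubeDiff e g (a ∘ π) = cubeDiff (π e) g a := by
  simp only [cubeDiff, flipBit_comp_perm, hg, Function.comp_apply]

variable [Fintype ι]

/-- Only increases need a bound: a decrease from `a` is an increase from `flipBit e a`. This suits a
minimum, where the optimizer at `a` controls only increases. -/
theorem expect_abs_cubeDiff_le {e : ι} {g w : (ι → Bool) → ℝ} (hw : ∀ a, 0 ≤ w a)
    (h : ∀ a, g (flipBit e a) - g a ≤ w a) : (𝔼 a, |cubeDiff e g a|) ≤ 𝔼 a, w a := by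
  rw [expect_eq_expect_half_add_flipBit e w]
  refine Finset.expect_le_expect fun a _ => ?_
  rw [abs_cubeDiff]
  have h1 := h a
  have h2 := h (flipBit e a)
  rw [flipBit_flipBit] at h2
  have : |g a - g (flipBit e a)| ≤ w a + w (flipBit e a) := by
    rw [abs_le]; constructor <;> linarith [hw a, hw (flipBit e a)]
  linarith

theorem expect_cubeDiff_sq_le {e : ι} {g w : (ι → Bool) → ℝ} (hw : ∀ a, 0 ≤ w a)
    (h : ∀ a, g (flipBit e a) - g a ≤ w a) :
    (𝔼 a, cubeDiff e g a ^ 2) ≤ 𝔼 a, w a ^ 2 := by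
  rw [expect_eq_expect_half_add_flipBit e fun a => w a ^ 2]
  refine Finset.expect_le_expect fun a _ => ?_
  rw [← sq_abs, abs_cubeDiff]
  have h1 := h a
  have h2 := h (flipBit e a)
  rw [flipBit_flipBit] at h2
  have : |g a - g (flipBit e a)| ≤ w a + w (flipBit e a) := by
    rw [abs_le]; constructor <;> linarith [hw a, hw (flipBit e a)]
  have h3 := pow_le_pow_left₀ (abs_nonneg _) this 2
  nlinarith [sq_nonneg (w a - w (flipBit e a))]

theorem expect_comp_cubeDiff_perm {g : (ι → Bool) → ℝ} {π : Equiv.Perm ι}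
    (hg : ∀ a, g (a ∘ π) = g a) (e : ι) (φ : ℝ → ℝ) :
    (𝔼 a, φ (cubeDiff (π e) g a)) = 𝔼 a, φ (cubeDiff e g a) := by
  refine Fintype.expect_equiv (Equiv.arrowCongr π.symm (Equiv.refl Bool)) _ _ fun a => ?_
  rw [← cubeDiff_comp_perm hg]
  rfl

end cube

/-! ### Sensitivity of the shifted `ℓ^p` norm -/

theorem mul_rpow_mul_sub_le {p x y : ℝ} (hp : 1 ≤ p) (hx : 0 < x) (hy : 0 ≤ y) :
    p * x ^ (p - 1) * (y - x) ≤ y ^ p - x ^ p := by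
  have h := one_add_mul_self_le_rpow_one_add (s := y / x - 1) (by linarith [div_nonneg hy hx.le]) hp
  have hxp : 0 < x ^ p := Real.rpow_pos_of_pos hx p
  have e : (1 + (y / x - 1)) ^ p = y ^ p / x ^ p := by
    rw [← Real.div_rpow hy hx.le]; congr 1; ring
  rw [e, le_div_iff₀ hxp] at h
  have e2 : x ^ (p - 1) = x ^ p / x := by rw [Real.rpow_sub hx, Real.rpow_one]
  rw [e2]
  have e3 : p * (x ^ p / x) * (y - x) = p * (y / x - 1) * x ^ p := by field_simp
  rw [e3]
  linarith

/-- The `ℓ^p` norm of the vector with entries `|y i| + ε`. -/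
noncomputable def shiftedNorm {n : ℕ} (p ε : ℝ) (y : Fin n → ℝ) : ℝ :=
  (∑ i, (|y i| + ε) ^ p) ^ (1 / p)

section shiftedNorm

variable {n : ℕ} {p ε : ℝ}

theorem shiftedNorm_pos (hn : 0 < n) (hε : 0 < ε) (y : Fin n → ℝ) : 0 < shiftedNorm p ε y := by
  have : Nonempty (Fin n) := ⟨⟨0, hn⟩⟩
  exact Real.rpow_pos_of_pos (Finset.sum_pos (fun i _ => Real.rpow_pos_of_pos (by positivity) _)
    Finset.univ_nonempty) _

theorem shiftedNorm_rpow (hp : 0 < p) (hε : 0 < ε) (y : Fin n → ℝ) :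
    shiftedNorm p ε y ^ p = ∑ i, (|y i| + ε) ^ p := by
  rw [shiftedNorm, ← Real.rpow_mul (Finset.sum_nonneg fun i _ => by positivity),
    one_div_mul_cancel hp.ne', Real.rpow_one]

theorem shiftedNorm_comp_perm (π : Equiv.Perm (Fin n)) (y : Fin n → ℝ) :
    shiftedNorm p ε (y ∘ π) = shiftedNorm p ε y := by
  unfold shiftedNorm
  congr 1
  exact Fintype.sum_equiv π _ _ fun _ => rfl

/-- Convexity of `x^p` is used twice, at the old norm and at the new coordinate. The shift keeps
every coordinate at least `ε`, so a change by `δ` multiplies it by at most `1 + δ/ε`. -/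
theorem shiftedNorm_sub_le {δ : ℝ} (hp : 1 ≤ p) (hε : 0 < ε) (hδ : 0 ≤ δ) {y y' : Fin n → ℝ}
    (i : Fin n) (hne : ∀ j, j ≠ i → y' j = y j) (hi : |y' i| ≤ |y i| + δ) :
    shiftedNorm p ε y' - shiftedNorm p ε y ≤
      δ * (1 + δ / ε) ^ (p - 1) * ((|y i| + ε) / shiftedNorm p ε y) ^ (p - 1) := by
  have hn : 0 < n := i.pos
  have hp0 : 0 < p := by linarith
  set S := shiftedNorm p ε y with hS
  set S' := shiftedNorm p ε y' with hS'
  have hS0 : 0 < S := shiftedNorm_pos hn hε y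
  have hS0' : 0 < S' := shiftedNorm_pos hn hε y'
  set a := |y i| + ε with ha
  set a' := |y' i| + ε with ha'
  have ha0 : 0 < a := by positivity
  have ha0' : 0 < a' := by positivity
  have hrhs : 0 ≤ δ * (1 + δ / ε) ^ (p - 1) * (a / S) ^ (p - 1) := by positivity
  have hdiff : S' ^ p - S ^ p = a' ^ p - a ^ p := by
    rw [hS, hS', shiftedNorm_rpow hp0 hε, shiftedNorm_rpow hp0 hε,
      ← Finset.sum_erase_add _ _ (Finset.mem_univ i), ← Finset.sum_erase_add Finset.univ _
        (Finset.mem_univ i)]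
    rw [Finset.sum_congr rfl fun j hj => by rw [hne j (Finset.ne_of_mem_erase hj)]]
    ring
  rcases le_total S' S with hle | hle
  · linarith
  have h1 := mul_rpow_mul_sub_le hp hS0 hS0'.le
  have h2 := mul_rpow_mul_sub_le hp ha0' ha0.le
  have hSp : 0 < S ^ (p - 1) := Real.rpow_pos_of_pos hS0 _
  have hap : 0 < a' ^ (p - 1) := Real.rpow_pos_of_pos ha0' _
  have h3 : S ^ (p - 1) * (S' - S) ≤ a' ^ (p - 1) * (a' - a) := by
    have : p * (S ^ (p - 1) * (S' - S)) ≤ p * (a' ^ (p - 1) * (a' - a)) := by linarith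
    exact le_of_mul_le_mul_left this hp0
  have h4 : a' ^ (p - 1) * (a' - a) ≤ a' ^ (p - 1) * δ :=
    mul_le_mul_of_nonneg_left (by rw [ha, ha']; linarith) hap.le
  have h5 : a' ≤ (1 + δ / ε) * a := by
    have h6 : δ ≤ δ / ε * a := by
      rw [div_mul_eq_mul_div, le_div_iff₀ hε]
      exact mul_le_mul_of_nonneg_left (by rw [ha]; linarith [abs_nonneg (y i)]) hδ
    have : a' ≤ a + δ := by rw [ha, ha']; linarith
    linarith
  have h7 : a' ^ (p - 1) ≤ (1 + δ / ε) ^ (p - 1) * a ^ (p - 1) := by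
    rw [← Real.mul_rpow (by positivity) ha0.le]
    exact Real.rpow_le_rpow ha0'.le h5 (by linarith)
  rw [Real.div_rpow ha0.le hS0.le, mul_div_assoc', le_div_iff₀ hSp]
  calc (S' - S) * S ^ (p - 1) ≤ a' ^ (p - 1) * δ := by linarith
    _ ≤ (1 + δ / ε) ^ (p - 1) * a ^ (p - 1) * δ := mul_le_mul_of_nonneg_right h7 hδ
    _ = _ := by ring

theorem sum_div_shiftedNorm_rpow (hn : 0 < n) (hp : 0 < p) (hε : 0 < ε) (y : Fin n → ℝ) :
    ∑ i, ((|y i| + ε) / shiftedNorm p ε y) ^ p = 1 := by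
  have hS := shiftedNorm_pos (p := p) hn hε y
  have : ∀ i, ((|y i| + ε) / shiftedNorm p ε y) ^ p
      = (|y i| + ε) ^ p / shiftedNorm p ε y ^ p := fun i => Real.div_rpow (by positivity) hS.le _
  simp only [this]
  rw [← Finset.sum_div, ← shiftedNorm_rpow hp hε y, div_self (Real.rpow_pos_of_pos hS p).ne']

/-- Each `r i ≤ 1`, and `2(p-1) ≥ p`. -/
theorem sum_sq_rpow_sub_one_le (hp : 2 ≤ p) {r : Fin n → ℝ} (hr : ∀ i, 0 ≤ r i)
    (hsum : ∑ i, r i ^ p = 1) : ∑ i, (r i ^ (p - 1)) ^ 2 ≤ 1 := by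
  rw [← hsum]
  refine Finset.sum_le_sum fun i _ => ?_
  have hr1 : r i ≤ 1 := by
    have h1 : r i ^ p ≤ 1 := by
      rw [← hsum]
      exact Finset.single_le_sum (f := fun i => r i ^ p) (fun j _ => Real.rpow_nonneg (hr j) _)
        (Finset.mem_univ i)
    by_contra! h
    exact absurd h1 (not_le.2 (Real.one_lt_rpow h (by linarith)))
  rw [← Real.rpow_natCast, ← Real.rpow_mul (hr i)]
  refine Real.rpow_le_rpow_of_exponent_ge_of_imp (hr i) hr1 (by push_cast; linarith) ?_
  intro _ h
  push_cast at h
  linarith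

theorem sum_rpow_sub_one_le (hp : 2 ≤ p) {r : Fin n → ℝ} (hr : ∀ i, 0 ≤ r i)
    (hsum : ∑ i, r i ^ p = 1) : ∑ i, r i ^ (p - 1) ≤ (n : ℝ) ^ (1 / p) := by
  have hpq : (p / (p - 1)).HolderConjugate p :=
    (Real.HolderConjugate.conjExponent (p := p) (by linarith)).symm
  have h := Real.inner_le_Lp_mul_Lq Finset.univ (fun i => r i ^ (p - 1)) (fun _ => (1 : ℝ)) hpq
  have e : ∀ i, |r i ^ (p - 1)| ^ (p / (p - 1)) = r i ^ p := fun i => by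
    rw [abs_of_nonneg (Real.rpow_nonneg (hr i) _), ← Real.rpow_mul (hr i),
      mul_div_cancel₀ _ (by linarith)]
  simpa [e, hsum] using h

theorem continuous_shiftedNorm (hp : 0 < p) :
    Continuous (shiftedNorm p ε : (Fin n → ℝ) → ℝ) := by
  unfold shiftedNorm
  refine Continuous.rpow_const (continuous_finsetSum _ fun i _ => ?_) fun _ =>
    Or.inr (by positivity)
  exact Continuous.rpow_const (by fun_prop) fun _ => Or.inr hp.le

end shiftedNorm

/-! ### Variance bound for matrices of normalized sign sums -/

/-- The discrepancy of a matrix with respect to `shiftedNorm p ε`. -/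
noncomputable def shiftedDisc {m n : ℕ} (p ε : ℝ) (A : Matrix (Fin m) (Fin n) ℝ) : ℝ :=
  (signVectors n).inf' (signVectors_nonempty n) fun σ => shiftedNorm p ε (A *ᵥ σ)

/-- The matrix of normalized sums of signs given by a point of the cube. -/
noncomputable def cubeMatrix {n m : ℕ} (a : (Fin n × Fin n) × Fin m → Bool) :
    Matrix (Fin n) (Fin n) ℝ :=
  Matrix.of fun i j => (√m)⁻¹ * ∑ k, bitSign (a ((i, j), k))

theorem abs_eq_one_of_mem_signVectors {n : ℕ} {σ : Fin n → ℝ} (hσ : σ ∈ signVectors n)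
    (j : Fin n) : |σ j| = 1 := by
  have := Fintype.mem_piFinset.1 hσ j
  simp only [Finset.mem_insert, Finset.mem_singleton] at this
  rcases this with h | h <;> simp [h]

section cubeMatrix

variable {n m : ℕ} {p ε : ℝ}

theorem cubeMatrix_flipBit_of_ne (a : (Fin n × Fin n) × Fin m → Bool) (e : (Fin n × Fin n) × Fin m)
    {i j : Fin n} (h : (i, j) ≠ e.1) : cubeMatrix (flipBit e a) i j = cubeMatrix a i j := by
  simp only [cubeMatrix, Matrix.of_apply]
  congr 1
  refine Finset.sum_congr rfl fun k _ => ?_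
  rw [flipBit_of_ne]
  rintro rfl
  exact h rfl

theorem abs_cubeMatrix_flipBit_sub (a : (Fin n × Fin n) × Fin m → Bool)
    (e : (Fin n × Fin n) × Fin m) :
    |cubeMatrix (flipBit e a) e.1.1 e.1.2 - cubeMatrix a e.1.1 e.1.2| = 2 * (√m)⁻¹ := by
  simp only [cubeMatrix, Matrix.of_apply]
  rw [← mul_sub, ← Finset.sum_sub_distrib, Finset.sum_eq_single e.2]
  · have : bitSign (flipBit e a e) - bitSign (a e) = -2 * bitSign (a e) := by
      rw [flipBit_same, bitSign_not]; ring
    change |(√m)⁻¹ * (bitSign (flipBit e a e) - bitSign (a e))| = _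
    rw [this, abs_mul, abs_mul, abs_bitSign, abs_of_nonneg (by positivity)]
    norm_num
    ring
  · intro k _ hk
    rw [flipBit_of_ne, sub_self]
    intro h
    exact hk (congrArg Prod.snd h)
  · simp

/-- The optimal `σ` at `a` remains a competitor after the flip, which moves a single coordinate of
the product by `2/√m`. -/
theorem shiftedDisc_flipBit_sub_le (hp : 1 ≤ p) (hε : 0 < ε)
    (a : (Fin n × Fin n) × Fin m → Bool) {σ : Fin n → ℝ} (hσ : σ ∈ signVectors n)
    (hmin : shiftedDisc p ε (cubeMatrix a) = shiftedNorm p ε (cubeMatrix a *ᵥ σ))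
    (e : (Fin n × Fin n) × Fin m) :
    shiftedDisc p ε (cubeMatrix (flipBit e a)) - shiftedDisc p ε (cubeMatrix a) ≤
      2 * (√m)⁻¹ * (1 + 2 * (√m)⁻¹ / ε) ^ (p - 1) *
        ((|(cubeMatrix a *ᵥ σ) e.1.1| + ε) / shiftedNorm p ε (cubeMatrix a *ᵥ σ)) ^ (p - 1) := by
  rw [hmin]
  refine (sub_le_sub_right (Finset.inf'_le _ hσ) _).trans ?_
  refine shiftedNorm_sub_le hp hε (by positivity) e.1.1 ?_ ?_
  · intro i hi
    simp only [Matrix.mulVec, dotProduct]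
    refine Finset.sum_congr rfl fun j _ => ?_
    rw [cubeMatrix_flipBit_of_ne]
    rintro h
    exact hi (congrArg Prod.fst h)
  · have : (cubeMatrix (flipBit e a) *ᵥ σ) e.1.1 - (cubeMatrix a *ᵥ σ) e.1.1 =
        (cubeMatrix (flipBit e a) e.1.1 e.1.2 - cubeMatrix a e.1.1 e.1.2) * σ e.1.2 := by
      simp only [Matrix.mulVec, dotProduct]
      rw [← Finset.sum_sub_distrib, Finset.sum_eq_single e.1.2]
      · ring
      · intro j _ hj
        rw [cubeMatrix_flipBit_of_ne, sub_self]
        intro h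
        exact hj (congrArg Prod.snd h)
      · simp
    have h2 : |(cubeMatrix (flipBit e a) *ᵥ σ) e.1.1 - (cubeMatrix a *ᵥ σ) e.1.1| =
        2 * (√m)⁻¹ := by
      rw [this, abs_mul, abs_eq_one_of_mem_signVectors hσ, mul_one, abs_cubeMatrix_flipBit_sub]
    have := abs_sub_abs_le_abs_sub ((cubeMatrix (flipBit e a) *ᵥ σ) e.1.1)
      ((cubeMatrix a *ᵥ σ) e.1.1)
    linarith

/-- The permutation of the coordinates of the cube induced by a permutation of the rows. -/
def rowPerm (π : Equiv.Perm (Fin n)) : Equiv.Perm ((Fin n × Fin n) × Fin m) :=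
  (π.prodCongr (Equiv.refl _)).prodCongr (Equiv.refl _)

theorem shiftedDisc_cubeMatrix_rowPerm (π : Equiv.Perm (Fin n))
    (a : (Fin n × Fin n) × Fin m → Bool) :
    shiftedDisc p ε (cubeMatrix (a ∘ rowPerm π)) = shiftedDisc p ε (cubeMatrix a) := by
  refine Finset.inf'_congr _ rfl fun σ _ => ?_
  rw [← shiftedNorm_comp_perm π (cubeMatrix a *ᵥ σ)]
  rfl

theorem variance_cube_le (hn : 0 < n) (hm : 0 < m) (hp : 2 ≤ p) (hε : 0 < ε) (R : ℝ) :
    (𝔼 a : (Fin n × Fin n) × Fin m → Bool, min (shiftedDisc p ε (cubeMatrix a)) R ^ 2) -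
      (𝔼 a : (Fin n × Fin n) × Fin m → Bool, min (shiftedDisc p ε (cubeMatrix a)) R) ^ 2 ≤
      4 * ((1 + 2 * (√m)⁻¹ / ε) ^ (p - 1)) ^ 2 * n *
        (2 / (1 + (1 / 2 - 1 / p) * Real.log n)) := by
  set g : ((Fin n × Fin n) × Fin m → Bool) → ℝ :=
    fun a => min (shiftedDisc p ε (cubeMatrix a)) R with hg
  set κ := (1 + 2 * (√m)⁻¹ / ε) ^ (p - 1) with hκ
  set δ := 2 * (√m)⁻¹ with hδ
  have hp1 : 1 ≤ p := by linarith
  have hn0 : (0 : ℝ) < n := by exact_mod_cast hn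
  have hm0 : (0 : ℝ) < m := by exact_mod_cast hm
  have hδ0 : 0 < δ := by positivity
  have hκ0 : 0 < κ := by positivity
  have hmin (a : (Fin n × Fin n) × Fin m → Bool) : ∃ σ ∈ signVectors n,
      shiftedDisc p ε (cubeMatrix a) = shiftedNorm p ε (cubeMatrix a *ᵥ σ) :=
    Finset.exists_mem_eq_inf' _ _
  choose σ hσ hσmin using hmin
  set r : ((Fin n × Fin n) × Fin m → Bool) → Fin n → ℝ := fun a i =>
    (|(cubeMatrix a *ᵥ σ a) i| + ε) / shiftedNorm p ε (cubeMatrix a *ᵥ σ a) with hr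
  have hr0 (a i) : 0 ≤ r a i := by
    have := shiftedNorm_pos (p := p) hn hε (cubeMatrix a *ᵥ σ a)
    simp only [hr]
    positivity
  have hrsum (a) : ∑ i, r a i ^ p = 1 := sum_div_shiftedNorm_rpow hn (by linarith) hε _
  have hw0 (a i) : 0 ≤ δ * κ * r a i ^ (p - 1) :=
    mul_nonneg (by positivity) (Real.rpow_nonneg (hr0 a i) _)
  have hstep (e : (Fin n × Fin n) × Fin m) (a) :
      g (flipBit e a) - g a ≤ δ * κ * r a e.1.1 ^ (p - 1) := by
    have h := shiftedDisc_flipBit_sub_le hp1 hε a (hσ a) (hσmin a) e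
    have h0 := hw0 a e.1.1
    simp only [hg]
    -- Truncation keeps the one-sided bound: where the value is already `R`, it cannot increase.
    rcases min_cases (shiftedDisc p ε (cubeMatrix a)) R with ⟨h1, -⟩ | ⟨h1, -⟩
    · rw [h1]
      exact (sub_le_sub_right (min_le_left _ _) _).trans h
    · rw [h1]
      linarith [min_le_right (shiftedDisc p ε (cubeMatrix (flipBit e a))) R]
  -- Swapping rows preserves the discrepancy, so every row carries the same influence, namely the
  -- average over all rows.
  have hsymm (φ : ℝ → ℝ) (i j k) :
      (n : ℝ) * (𝔼 a, φ (cubeDiff ((i, j), k) g a)) = ∑ i', 𝔼 a, φ (cubeDiff ((i', j), k) g a) := by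
    have : ∀ i' ∈ Finset.univ, (𝔼 a, φ (cubeDiff ((i', j), k) g a)) =
        𝔼 a, φ (cubeDiff ((i, j), k) g a) := by
      intro i' _
      rw [← expect_comp_cubeDiff_perm (π := rowPerm (Equiv.swap i i')) (g := g) _ ((i, j), k)]
      · simp [rowPerm]
      · intro a
        simp only [hg, shiftedDisc_cubeMatrix_rowPerm]
    rw [Finset.sum_congr rfl this]
    simp
  have hL : 0 ≤ (1 / 2 - 1 / p) * Real.log n := by
    refine mul_nonneg ?_ (Real.log_nonneg (by exact_mod_cast hn))
    rw [sub_nonneg]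
    exact one_div_le_one_div_of_le two_pos hp
  have hsqrt : √(n : ℝ) ^ 2 = n := Real.sq_sqrt hn0.le
  have hexp : Real.exp (-((1 / 2 - 1 / p) * Real.log n)) = (n : ℝ) ^ (1 / p) / √n := by
    rw [Real.sqrt_eq_rpow, ← Real.rpow_sub hn0, Real.rpow_def_of_pos hn0]
    congr 1
    ring
  -- The `L²` row average is `(δκ)²/n`, hence `τ`; the `L¹` row average is `δκ n^(1/p)/n = τ
  -- exp(-L)`. Over `n² m` bits with `δ² = 4/m`, the total `n² m τ²` is `4κ²n`.
  have key := expect_sq_sub_sq_expect_le g (τ := δ * κ / √n) (by positivity) hL ?_ ?_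
  · refine key.trans (le_of_eq ?_)
    congr 1
    have hmsq : √(m : ℝ) ^ 2 = m := Real.sq_sqrt hm0.le
    simp only [Fintype.card_prod, Fintype.card_fin, Nat.cast_mul, hδ]
    rw [div_pow, mul_pow, mul_pow, inv_pow, hmsq, hsqrt]
    field_simp
    norm_num
  · rintro ⟨⟨i, j⟩, k⟩
    rw [hexp]
    have h := hsymm (fun x => |x|) i j k
    have h2 : ∑ i', (𝔼 a, |cubeDiff ((i', j), k) g a|) ≤ δ * κ * (n : ℝ) ^ (1 / p) := by
      refine (Finset.sum_le_sum fun i' _ => expect_abs_cubeDiff_le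
        (fun a => hw0 a i') (hstep ((i', j), k))).trans ?_
      rw [← Finset.expect_sum_comm]
      refine (Finset.expect_le_expect fun a _ => ?_).trans (Finset.expect_const
        Finset.univ_nonempty _).le
      rw [← Finset.mul_sum]
      exact mul_le_mul_of_nonneg_left (sum_rpow_sub_one_le hp (hr0 a) (hrsum a)) (by positivity)
    rw [← h] at h2
    rw [div_mul_div_comm, Real.mul_self_sqrt hn0.le, le_div_iff₀ hn0]
    linarith
  · rintro ⟨⟨i, j⟩, k⟩
    have h := hsymm (fun x => x ^ 2) i j k
    have h2 : ∑ i', (𝔼 a, cubeDiff ((i', j), k) g a ^ 2) ≤ (δ * κ) ^ 2 := by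
      refine (Finset.sum_le_sum fun i' _ => expect_cubeDiff_sq_le
        (fun a => hw0 a i') (hstep ((i', j), k))).trans ?_
      rw [← Finset.expect_sum_comm]
      refine (Finset.expect_le_expect fun a _ => ?_).trans (Finset.expect_const
        Finset.univ_nonempty _).le
      simp only [mul_pow _ (r a _ ^ (p - 1))]
      rw [← Finset.mul_sum]
      exact mul_le_of_le_one_right (by positivity) (sum_sq_rpow_sub_one_le hp (hr0 a) (hrsum a))
    rw [← h] at h2
    rw [div_pow, hsqrt, le_div_iff₀ hn0]
    linarith

end cubeMatrix

/-! ### Central limit theorem for sign sums -/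

theorem integral_uniformOfFintype {α E : Type*} [Fintype α] [Nonempty α] [MeasurableSpace α]
    [MeasurableSingletonClass α] [NormedAddCommGroup E] [NormedSpace ℝ E] [CompleteSpace E]
    (f : α → E) : ∫ a, f a ∂(PMF.uniformOfFintype α).toMeasure
      = (Fintype.card α : ℝ)⁻¹ • ∑ a, f a := by
  rw [PMF.integral_eq_sum]
  simp [PMF.uniformOfFintype_apply, Finset.smul_sum]

theorem tendsto_cos_pow (t : ℝ) :
    Tendsto (fun n : ℕ => (Complex.cos (((√n)⁻¹ * t : ℝ) : ℂ)) ^ n) atTop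
      (𝓝 (Complex.exp (-t ^ 2 / 2))) := by
  have h := tendsto_charFun_inv_sqrt_mul_pow (P := (PMF.uniformOfFintype Bool).toMeasure)
    (X := bitSign) (measurable_of_countable _).aemeasurable
    (by rw [integral_uniformOfFintype]; simp [bitSign])
    (by rw [integral_uniformOfFintype]; simp [bitSign]; norm_num) t
  refine h.congr fun n => ?_
  congr 1
  rw [charFun_apply, integral_map (measurable_of_countable _).aemeasurable (by fun_prop),
    integral_uniformOfFintype]
  simp only [Fintype.card_bool, Fintype.sum_bool, bitSign, Complex.cos]
  simp
  ring_nf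

section clt

variable {κ : Type*} [Fintype κ]

/-- The vector of normalized sums of signs given by a point of the cube. -/
noncomputable def cubeSum {m : ℕ} (a : κ × Fin m → Bool) (p : κ) : ℝ :=
  (√m)⁻¹ * ∑ k, bitSign (a (p, k))

theorem charFun_map_cubeSum [DecidableEq κ] (m : ℕ) (t : EuclideanSpace ℝ κ) :
    charFun ((PMF.uniformOfFintype (κ × Fin m → Bool)).toMeasure.map
      fun a => WithLp.toLp 2 (cubeSum a)) t = ∏ p, Complex.cos (((√m)⁻¹ * t p : ℝ) : ℂ) ^ m := by
  rw [charFun_apply, integral_map (measurable_of_countable _).aemeasurable (by fun_prop),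
    integral_uniformOfFintype]
  have h1 (a : κ × Fin m → Bool) :
      Complex.exp (((inner ℝ (WithLp.toLp 2 (cubeSum a)) t : ℝ) : ℂ) * Complex.I) =
      ∏ e : κ × Fin m, Complex.exp ((bitSign (a e) * ((√m)⁻¹ * t e.1) : ℝ) * Complex.I) := by
    rw [← Complex.exp_sum, ← Finset.sum_mul]
    congr 2
    rw [← Complex.ofReal_sum, ← Finset.univ_product_univ, Finset.sum_product, PiLp.inner_apply]
    congr 1
    refine Finset.sum_congr rfl fun p _ => ?_
    simp only [cubeSum, ← Finset.sum_mul]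
    simp
    ring
  simp only [h1]
  rw [← Fintype.prod_sum (fun (e : κ × Fin m) b =>
    Complex.exp ((bitSign b * ((√m)⁻¹ * t e.1) : ℝ) * Complex.I))]
  have h2 (e : κ × Fin m) : ∑ b, Complex.exp ((bitSign b * ((√m)⁻¹ * t e.1) : ℝ) * Complex.I) =
      2 * Complex.cos (((√m)⁻¹ * t e.1 : ℝ) : ℂ) := by
    rw [Complex.two_cos]
    simp [bitSign]
  simp only [h2]
  have h3 : ∏ e : κ × Fin m, Complex.cos (((√m)⁻¹ * t e.1 : ℝ) : ℂ) =
      ∏ p, Complex.cos (((√m)⁻¹ * t p : ℝ) : ℂ) ^ m := by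
    rw [Fintype.prod_prod_type]
    simp
  rw [Finset.prod_mul_distrib, h3, ← smul_mul_assoc]
  simp

/-- The central limit theorem for sums of independent random signs in finite dimension. -/
theorem tendsto_expect_cubeSum [DecidableEq κ] {Ψ : (κ → ℝ) → ℝ} (hΨ : Continuous Ψ) {C : ℝ}
    (hC : ∀ x, |Ψ x| ≤ C) :
    Tendsto (fun m : ℕ => 𝔼 a : κ × Fin m → Bool, Ψ (cubeSum a)) atTop
      (𝓝 (∫ x, Ψ x ∂Measure.pi fun _ => gaussianReal 0 1)) := by
  have hmeas (m : ℕ) : AEMeasurable (fun a : κ × Fin m → Bool => WithLp.toLp 2 (cubeSum a))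
    (PMF.uniformOfFintype (κ × Fin m → Bool)).toMeasure := (measurable_of_countable _).aemeasurable
  have hlp : AEMeasurable (WithLp.toLp 2 : (κ → ℝ) → EuclideanSpace ℝ κ)
    (Measure.pi fun _ => gaussianReal 0 1) := by fun_prop
  let μ (m : ℕ) : ProbabilityMeasure (EuclideanSpace ℝ κ) :=
    ⟨_, Measure.isProbabilityMeasure_map (hmeas m)⟩
  let ν : ProbabilityMeasure (EuclideanSpace ℝ κ) := ⟨_, Measure.isProbabilityMeasure_map hlp⟩
  have hμν : Tendsto μ atTop (𝓝 ν) := by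
    refine ProbabilityMeasure.tendsto_iff_tendsto_charFun.2 fun t => ?_
    have e1 (m : ℕ) : charFun (μ m : Measure (EuclideanSpace ℝ κ)) t
        = ∏ p, Complex.cos (((√m)⁻¹ * t p : ℝ) : ℂ) ^ m := charFun_map_cubeSum m t
    have e2 : charFun (ν : Measure (EuclideanSpace ℝ κ)) t
        = ∏ p, Complex.exp (-t p ^ 2 / 2) := by
      refine (charFun_pi t).trans (Finset.prod_congr rfl fun p _ => ?_)
      rw [charFun_gaussianReal]
      simp [neg_div]
    simp only [e1, e2]
    exact tendsto_finsetProd _ fun p _ => tendsto_cos_pow (t p)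
  have h := ProbabilityMeasure.tendsto_iff_forall_integral_tendsto.1 hμν
    (BoundedContinuousFunction.ofNormedAddCommGroup (fun x => Ψ x.ofLp) (by fun_prop) C
      fun x => hC _)
  have hΨm : AEStronglyMeasurable (fun x : EuclideanSpace ℝ κ => Ψ x.ofLp)
      (ν : Measure (EuclideanSpace ℝ κ)) :=
    (show Continuous fun x : EuclideanSpace ℝ κ => Ψ x.ofLp by fun_prop).aestronglyMeasurable
  have e3 : ∫ x, Ψ (x.ofLp) ∂(ν : Measure (EuclideanSpace ℝ κ))
      = ∫ x, Ψ x ∂Measure.pi fun _ => gaussianReal 0 1 := integral_map hlp hΨm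
  have e4 (m : ℕ) : ∫ x, Ψ (x.ofLp) ∂(μ m : Measure (EuclideanSpace ℝ κ))
      = 𝔼 a : κ × Fin m → Bool, Ψ (cubeSum a) := by
    refine (integral_map (hmeas m) (show Continuous fun x : EuclideanSpace ℝ κ =>
      Ψ x.ofLp by fun_prop).aestronglyMeasurable).trans ?_
    rw [integral_uniformOfFintype, Fintype.expect_eq_sum_div_card, smul_eq_mul, div_eq_inv_mul]
  simp only [BoundedContinuousFunction.coe_ofNormedAddCommGroup, e3, e4] at h
  exact h

end clt

/-! ### Variance of the truncated shifted discrepancy of a Gaussian matrix -/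

/-- The law of the entries of a Gaussian matrix. -/
noncomputable def gaussianEntries (n : ℕ) : Measure (Fin n × Fin n → ℝ) :=
  Measure.pi fun _ => gaussianReal 0 1

instance (n : ℕ) : IsProbabilityMeasure (gaussianEntries n) :=
  inferInstanceAs (IsProbabilityMeasure (Measure.pi _))

/-- The square matrix with given entries. -/
def entriesMatrix {n : ℕ} (x : Fin n × Fin n → ℝ) : Matrix (Fin n) (Fin n) ℝ :=
  Matrix.of fun i j => x (i, j)

theorem continuous_entriesMatrix_mulVec {n : ℕ} (σ : Fin n → ℝ) :
    Continuous fun x : Fin n × Fin n → ℝ => entriesMatrix x *ᵥ σ := by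
  refine continuous_pi fun i => ?_
  simp only [entriesMatrix, Matrix.mulVec, dotProduct, Matrix.of_apply]
  fun_prop

theorem continuous_shiftedDisc {n : ℕ} {p ε : ℝ} (hp : 0 < p) :
    Continuous fun x : Fin n × Fin n → ℝ => shiftedDisc p ε (entriesMatrix x) := by
  have : (fun x : Fin n × Fin n → ℝ => shiftedDisc p ε (entriesMatrix x)) =
      (signVectors n).inf' (signVectors_nonempty n)
        fun σ x => shiftedNorm p ε (entriesMatrix x *ᵥ σ) := by
    funext x
    rw [Finset.inf'_apply]
    rfl
  rw [this]
  exact Continuous.finset_inf' _ fun σ _ =>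
    (continuous_shiftedNorm hp).comp (continuous_entriesMatrix_mulVec σ)

theorem shiftedNorm_nonneg {n : ℕ} {p ε : ℝ} (hε : 0 ≤ ε) (y : Fin n → ℝ) :
    0 ≤ shiftedNorm p ε y :=
  Real.rpow_nonneg (Finset.sum_nonneg fun _ _ => Real.rpow_nonneg (by positivity) _) _

theorem shiftedDisc_nonneg {m n : ℕ} {p ε : ℝ} (hε : 0 ≤ ε) (A : Matrix (Fin m) (Fin n) ℝ) :
    0 ≤ shiftedDisc p ε A :=
  Finset.le_inf' _ _ fun _ _ => shiftedNorm_nonneg hε _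

theorem variance_min_shiftedDisc_le {n : ℕ} (hn : 0 < n) {p ε R : ℝ} (hp : 2 ≤ p) (hε : 0 < ε)
    (hR : 0 ≤ R) :
    (∫ x, min (shiftedDisc p ε (entriesMatrix x)) R ^ 2 ∂gaussianEntries n) -
      (∫ x, min (shiftedDisc p ε (entriesMatrix x)) R ∂gaussianEntries n) ^ 2 ≤
      4 * n * (2 / (1 + (1 / 2 - 1 / p) * Real.log n)) := by
  have hcont : Continuous fun x : Fin n × Fin n → ℝ =>
      min (shiftedDisc p ε (entriesMatrix x)) R :=
    (continuous_shiftedDisc (by linarith)).min continuous_const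
  have hbound (x : Fin n × Fin n → ℝ) : |min (shiftedDisc p ε (entriesMatrix x)) R| ≤ R := by
    rw [abs_of_nonneg (le_min (shiftedDisc_nonneg hε.le _) hR)]
    exact min_le_right _ _
  have h1 := tendsto_expect_cubeSum hcont hbound
  have h2 := tendsto_expect_cubeSum (hcont.pow 2) (C := R ^ 2) fun x => by
    simp only [Pi.pow_apply, abs_pow]
    exact pow_le_pow_left₀ (abs_nonneg _) (hbound x) 2
  -- For fixed `ε` the discretization factor tends to `1` as `m → ∞`, so the limiting bound no
  -- longer involves `ε` or `R`.
  have hκ : Tendsto (fun m : ℕ => 4 * ((1 + 2 * (√m)⁻¹ / ε) ^ (p - 1)) ^ 2 * n *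
      (2 / (1 + (1 / 2 - 1 / p) * Real.log n))) atTop
      (𝓝 (4 * ((1 + 2 * 0 / ε) ^ (p - 1)) ^ 2 * n *
        (2 / (1 + (1 / 2 - 1 / p) * Real.log n)))) := by
    have h0 : Tendsto (fun m : ℕ => (√(m : ℝ))⁻¹) atTop (𝓝 0) :=
      tendsto_inv_atTop_zero.comp (Real.tendsto_sqrt_atTop.comp tendsto_natCast_atTop_atTop)
    refine (((((h0.const_mul 2).div_const ε).const_add 1).rpow_const
      (Or.inr (by linarith))).pow 2 |>.const_mul 4 |>.mul_const _ |>.mul_const _)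
  have := le_of_tendsto_of_tendsto (h2.sub (h1.pow 2)) hκ
    (eventually_atTop.2 ⟨1, fun m hm => variance_cube_le hn (by omega) hp hε R⟩)
  refine this.trans (le_of_eq ?_)
  simp

/-! ### Passage to the `ℓ^q` discrepancy -/

theorem shiftedNorm_le_sum {n : ℕ} {p ε : ℝ} (hp : 1 ≤ p) (hε : 0 ≤ ε) (y : Fin n → ℝ) :
    shiftedNorm p ε y ≤ ∑ i, (|y i| + ε) := by
  have h0 (i) : 0 ≤ |y i| + ε := by positivity
  have hsum : 0 ≤ ∑ i, (|y i| + ε) := Finset.sum_nonneg fun i _ => h0 i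
  have hp0 : 0 < p := by linarith
  have h : ∑ i, (|y i| + ε) ^ p ≤ (∑ i, (|y i| + ε)) ^ p := by
    calc ∑ i, (|y i| + ε) ^ p = ∑ i, (|y i| + ε) * (|y i| + ε) ^ (p - 1) := by
          refine Finset.sum_congr rfl fun i _ => ?_
          rw [← Real.rpow_one_add' (h0 i) (by linarith)]
          congr 1
          ring
      _ ≤ ∑ i, (|y i| + ε) * (∑ i, (|y i| + ε)) ^ (p - 1) := by
          refine Finset.sum_le_sum fun i hi => mul_le_mul_of_nonneg_left ?_ (h0 i)
          exact Real.rpow_le_rpow (h0 i) (Finset.single_le_sum (fun j _ => h0 j) hi) (by linarith)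
      _ = (∑ i, (|y i| + ε)) ^ p := by
          rw [← Finset.sum_mul, ← Real.rpow_one_add' hsum (by linarith)]
          congr 1
          ring
  calc shiftedNorm p ε y ≤ ((∑ i, (|y i| + ε)) ^ p) ^ (1 / p) :=
        Real.rpow_le_rpow (Finset.sum_nonneg fun i _ => Real.rpow_nonneg (h0 i) _) h (by positivity)
    _ = _ := by rw [← Real.rpow_mul hsum, mul_one_div_cancel hp0.ne', Real.rpow_one]

theorem shiftedNorm_le_norm {n : ℕ} {p ε : ℝ} (hp : 0 < p) (hε : 0 ≤ ε) (y : Fin n → ℝ) :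
    shiftedNorm p ε y ≤ (n : ℝ) ^ (1 / p) * (‖y‖ + ε) := by
  have h : ∑ i, (|y i| + ε) ^ p ≤ n * (‖y‖ + ε) ^ p := by
    refine (Finset.sum_le_card_nsmul _ _ ((‖y‖ + ε) ^ p) fun i _ => ?_).trans (by simp)
    exact Real.rpow_le_rpow (by positivity) (by simpa using norm_le_pi_norm y i) hp.le
  refine (Real.rpow_le_rpow (Finset.sum_nonneg fun i _ => by positivity) h
    (by positivity)).trans (le_of_eq ?_)
  rw [Real.mul_rpow (by positivity) (by positivity), ← Real.rpow_mul (by positivity),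
    mul_one_div_cancel hp.ne', Real.rpow_one]

theorem norm_le_shiftedNorm {n : ℕ} {p ε : ℝ} (hp : 0 < p) (hε : 0 ≤ ε) (y : Fin n → ℝ) :
    ‖y‖ ≤ shiftedNorm p ε y := by
  refine (pi_norm_le_iff_of_nonneg (shiftedNorm_nonneg hε y)).2 fun i => ?_
  have h0 : 0 ≤ |y i| + ε := by positivity
  calc ‖y i‖ ≤ ((|y i| + ε) ^ p) ^ (1 / p) := by
        rw [← Real.rpow_mul h0, mul_one_div_cancel hp.ne', Real.rpow_one, Real.norm_eq_abs]
        linarith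
    _ ≤ shiftedNorm p ε y := Real.rpow_le_rpow (Real.rpow_nonneg h0 _)
        (Finset.single_le_sum (f := fun i => (|y i| + ε) ^ p)
          (fun j _ => Real.rpow_nonneg (by positivity) _) (Finset.mem_univ i)) (by positivity)

/-- For finite `q` the exponent is constant and only the shift vanishes. For `q = ∞` the exponents
`k + 2` grow, and the norm is squeezed between `‖y‖` and `n^(1/p)(‖y‖ + ε)`. -/
theorem exists_tendsto_shiftedNorm {n : ℕ} (hn : 0 < n) {q : ℝ≥0∞} (hq : 2 ≤ q) :
    ∃ p : ℕ → ℝ, (∀ k, 2 ≤ p k) ∧ Tendsto (fun k => 1 / p k) atTop (𝓝 (q⁻¹).toReal) ∧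
      ∀ y : Fin n → ℝ, Tendsto (fun k : ℕ => shiftedNorm (p k) (1 / ((k : ℝ) + 1)) y) atTop
        (𝓝 ‖(WithLp.toLp q y : PiLp q fun _ : Fin n => ℝ)‖) := by
  have hε : Tendsto (fun k : ℕ => 1 / ((k : ℝ) + 1)) atTop (𝓝 0) :=
    tendsto_one_div_add_atTop_nhds_zero_nat
  rcases eq_or_ne q ⊤ with rfl | hqt
  · have hp (k : ℕ) : (0 : ℝ) < (k : ℝ) + 2 := by positivity
    have hlim : Tendsto (fun k : ℕ => 1 / ((k : ℝ) + 2)) atTop (𝓝 0) := by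
      simp only [one_div]
      exact tendsto_inv_atTop_zero.comp
        (tendsto_atTop_add_const_right _ _ tendsto_natCast_atTop_atTop)
    refine ⟨fun k => k + 2, fun k => by linarith [Nat.cast_nonneg (α := ℝ) k], by simpa using hlim,
      fun y => ?_⟩
    rw [PiLp.norm_toLp]
    have hup : Tendsto (fun k : ℕ => (n : ℝ) ^ (1 / ((k : ℝ) + 2)) * (‖y‖ + 1 / ((k : ℝ) + 1)))
        atTop (𝓝 ((n : ℝ) ^ (0 : ℝ) * (‖y‖ + 0))) :=
      (tendsto_const_nhds.rpow hlim (Or.inl (by positivity))).mul (hε.const_add _)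
    rw [Real.rpow_zero, one_mul, add_zero] at hup
    exact tendsto_of_tendsto_of_tendsto_of_le_of_le tendsto_const_nhds hup
      (fun k => norm_le_shiftedNorm (hp k) (by positivity) y)
      (fun k => shiftedNorm_le_norm (hp k) (by positivity) y)
  · have hp : 2 ≤ q.toReal := by simpa using ENNReal.toReal_mono hqt hq
    have hp0 : 0 < q.toReal := by linarith
    refine ⟨fun _ => q.toReal, fun _ => hp, ?_, fun y => ?_⟩
    · rw [ENNReal.toReal_inv, ← one_div]
      exact tendsto_const_nhds
    · rw [PiLp.norm_eq_sum hp0]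
      have h : Tendsto (fun k : ℕ => shiftedNorm q.toReal (1 / ((k : ℝ) + 1)) y) atTop
          (𝓝 ((∑ i, (|y i| + 0) ^ q.toReal) ^ (1 / q.toReal))) :=
        (tendsto_finsetSum _ fun i _ => (hε.const_add _).rpow_const (Or.inr hp0.le)).rpow_const
          (Or.inr (by positivity))
      simpa using h

theorem continuous_lqDisc {n : ℕ} {q : ℝ≥0∞} (hq : 1 ≤ q) :
    Continuous fun x : Fin n × Fin n → ℝ => lqDisc q (entriesMatrix x) := by
  have : Fact (1 ≤ q) := ⟨hq⟩
  have : (fun x : Fin n × Fin n → ℝ => lqDisc q (entriesMatrix x)) =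
      (signVectors n).inf' (signVectors_nonempty n) fun σ x =>
        ‖(WithLp.toLp q (entriesMatrix x *ᵥ σ) : PiLp q fun _ : Fin n => ℝ)‖ := by
    funext x
    rw [Finset.inf'_apply]
    rfl
  rw [this]
  exact Continuous.finset_inf' _ fun σ _ =>
    ((PiLp.continuous_toLp q _).comp (continuous_entriesMatrix_mulVec σ)).norm

/-- The sum of the absolute values of the entries, plus the dimension: an envelope for `shiftedDisc`
and `lqDisc`. -/
noncomputable def entriesEnvelope {n : ℕ} (x : Fin n × Fin n → ℝ) : ℝ := ∑ p, |x p| + n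

theorem memLp_entriesEnvelope (n : ℕ) : MemLp (entriesEnvelope (n := n)) 2 (gaussianEntries n) := by
  refine MemLp.add (memLp_finsetSum _ fun p _ => ?_) (memLp_const _)
  have h : MemLp (fun y : ℝ => |y|) 2 (gaussianReal 0 1) :=
    (memLp_id_gaussianReal' 2 (by simp)).norm
  exact h.comp_measurePreserving (measurePreserving_eval _ p)

theorem shiftedDisc_le_entriesEnvelope {n : ℕ} {p ε : ℝ} (hp : 1 ≤ p) (hε : 0 ≤ ε) (hε1 : ε ≤ 1)
    (x : Fin n × Fin n → ℝ) : shiftedDisc p ε (entriesMatrix x) ≤ entriesEnvelope x := by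
  obtain ⟨σ, hσ⟩ := signVectors_nonempty n
  refine (Finset.inf'_le _ hσ).trans ((shiftedNorm_le_sum hp hε _).trans ?_)
  rw [Finset.sum_add_distrib, entriesEnvelope, Fintype.sum_prod_type]
  refine add_le_add (Finset.sum_le_sum fun i _ => ?_)
    (by simpa using mul_le_of_le_one_right (Nat.cast_nonneg (α := ℝ) n) hε1)
  simp only [Matrix.mulVec, dotProduct]
  refine (Finset.abs_sum_le_sum_abs _ _).trans (le_of_eq ?_)
  refine Finset.sum_congr rfl fun j _ => ?_
  rw [abs_mul, abs_eq_one_of_mem_signVectors hσ, mul_one]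
  rfl

theorem lqDisc_nonneg {m n : ℕ} {q : ℝ≥0∞} (hq : 1 ≤ q) (A : Matrix (Fin m) (Fin n) ℝ) :
    0 ≤ lqDisc q A := by
  have : Fact (1 ≤ q) := ⟨hq⟩
  exact Finset.le_inf' _ _ fun _ _ => norm_nonneg _

section limit

variable {n : ℕ} {q : ℝ≥0∞}

theorem exists_tendsto_shiftedDisc (hn : 0 < n) (hq : 2 ≤ q) :
    ∃ p : ℕ → ℝ, (∀ k, 2 ≤ p k) ∧ Tendsto (fun k => 1 / p k) atTop (𝓝 (q⁻¹).toReal) ∧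
      ∀ A : Matrix (Fin n) (Fin n) ℝ,
        Tendsto (fun k : ℕ => min (shiftedDisc (p k) (1 / ((k : ℝ) + 1)) A) (k : ℝ)) atTop
          (𝓝 (lqDisc q A)) := by
  obtain ⟨p, hp, hp', hlim⟩ := exists_tendsto_shiftedNorm hn hq
  refine ⟨p, hp, hp', fun A => ?_⟩
  have h : Tendsto (fun k : ℕ => shiftedDisc (p k) (1 / ((k : ℝ) + 1)) A) atTop
      (𝓝 (lqDisc q A)) := Tendsto.finset_inf'_nhds_apply _ fun σ _ => hlim (A *ᵥ σ)
  refine h.congr' ?_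
  filter_upwards [h.eventually_le_const (lt_add_one (lqDisc q A)),
    tendsto_natCast_atTop_atTop.eventually_ge_atTop (lqDisc q A + 1)] with k h1 h2
  rw [min_eq_left (h1.trans h2)]

theorem lqDisc_le_entriesEnvelope (hn : 0 < n) (hq : 2 ≤ q) (x : Fin n × Fin n → ℝ) :
    lqDisc q (entriesMatrix x) ≤ entriesEnvelope x := by
  obtain ⟨p, hp, -, hlim⟩ := exists_tendsto_shiftedDisc hn hq
  refine le_of_tendsto (hlim (entriesMatrix x)) (Eventually.of_forall fun k => ?_)
  refine (min_le_left _ _).trans (shiftedDisc_le_entriesEnvelope (by linarith [hp k])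
    (by positivity) ?_ x)
  rw [div_le_one (by positivity)]
  linarith [Nat.cast_nonneg (α := ℝ) k]

theorem memLp_lqDisc (hn : 0 < n) (hq : 2 ≤ q) :
    MemLp (fun x => lqDisc q (entriesMatrix x)) 2 (gaussianEntries n) := by
  have hq1 : 1 ≤ q := one_le_two.trans hq
  refine (memLp_entriesEnvelope n).of_le (continuous_lqDisc hq1).aestronglyMeasurable
    (Eventually.of_forall fun x => ?_)
  rw [Real.norm_of_nonneg (lqDisc_nonneg hq1 _)]
  exact (lqDisc_le_entriesEnvelope hn hq x).trans (le_abs_self _)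

/-- Shift, truncation and exponent are released together; the square-integrable envelope,
independent of `k`, gives convergence of both moments. -/
theorem variance_lqDisc_le (hn : 0 < n) (hq : 2 ≤ q) :
    Var[fun x => lqDisc q (entriesMatrix x); gaussianEntries n] ≤
      4 * n * (2 / (1 + (1 / 2 - (q⁻¹).toReal) * Real.log n)) := by
  rw [variance_eq_sub (memLp_lqDisc hn hq)]
  obtain ⟨p, hp, hp', hlim⟩ := exists_tendsto_shiftedDisc hn hq
  have hcont (k : ℕ) : Continuous fun x : Fin n × Fin n → ℝ =>
      min (shiftedDisc (p k) (1 / ((k : ℝ) + 1)) (entriesMatrix x)) (k : ℝ) :=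
    (continuous_shiftedDisc (by linarith [hp k])).min continuous_const
  have hbound (k : ℕ) (x : Fin n × Fin n → ℝ) :
      |min (shiftedDisc (p k) (1 / ((k : ℝ) + 1)) (entriesMatrix x)) (k : ℝ)| ≤
        entriesEnvelope x := by
    rw [abs_of_nonneg (le_min (shiftedDisc_nonneg (by positivity) _) (Nat.cast_nonneg k))]
    refine (min_le_left _ _).trans (shiftedDisc_le_entriesEnvelope (by linarith [hp k])
      (by positivity) ?_ x)
    rw [div_le_one (by positivity)]
    linarith [Nat.cast_nonneg (α := ℝ) k]
  have hB := memLp_entriesEnvelope n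
  have h1 := tendsto_integral_of_dominated_convergence (entriesEnvelope (n := n))
    (fun k => (hcont k).aestronglyMeasurable) (hB.integrable one_le_two)
    (fun k => Eventually.of_forall fun x => (hbound k x))
    (Eventually.of_forall fun x => hlim (entriesMatrix x))
  have h2 := tendsto_integral_of_dominated_convergence (fun x => entriesEnvelope (n := n) x ^ 2)
    (fun k => ((hcont k).pow 2).aestronglyMeasurable) hB.integrable_sq
    (fun k => Eventually.of_forall fun x => by
      simp only [Pi.pow_apply, norm_pow]
      exact pow_le_pow_left₀ (norm_nonneg _) (hbound k x) 2)
    (Eventually.of_forall fun x => (hlim (entriesMatrix x)).pow 2)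
  have hlog : 0 ≤ Real.log n := Real.log_nonneg (by exact_mod_cast hn)
  have hq2 : (q⁻¹).toReal ≤ 1 / 2 := le_of_tendsto hp' (Eventually.of_forall fun k =>
    one_div_le_one_div_of_le two_pos (hp k))
  have h3 : Tendsto (fun k => 4 * (n : ℝ) * (2 / (1 + (1 / 2 - 1 / p k) * Real.log n))) atTop
      (𝓝 (4 * n * (2 / (1 + (1 / 2 - (q⁻¹).toReal) * Real.log n)))) := by
    refine Tendsto.const_mul _ (Tendsto.div tendsto_const_nhds
      (((hp'.const_sub _).mul_const _).const_add _) ?_)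
    nlinarith
  exact le_of_tendsto_of_tendsto (h2.sub (h1.pow 2)) h3 (Eventually.of_forall fun k =>
    variance_min_shiftedDisc_le hn (hp k) (by positivity) (Nat.cast_nonneg k))

end limit

/-! ### Lower bound for the mean -/

theorem integral_exp_neg_mul_abs_gaussianReal_le {l : ℝ} (hl : 0 < l) :
    ∫ x, Real.exp (-l * |x|) ∂gaussianReal 0 1 ≤ 1 / l := by
  have hI : ∫ x : ℝ, Real.exp (-l * |x|) = 2 * (1 / l) := by
    rw [integral_comp_abs (f := fun x => Real.exp (-l * x)), integral_exp_mul_Ioi (by linarith)]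
    simp [neg_div_neg_eq]
  -- The Bochner integral of a nonintegrable function is `0`, so the positive value already computed
  -- forces integrability.
  have hint : Integrable fun x : ℝ => Real.exp (-l * |x|) := by
    by_contra h
    rw [integral_undef h] at hI
    have : 0 < 2 * (1 / l) := by positivity
    linarith
  rw [integral_gaussianReal_eq_integral_smul one_ne_zero]
  calc ∫ x, gaussianPDFReal 0 1 x • Real.exp (-l * |x|)
      ≤ ∫ x, 1 / 2 * Real.exp (-l * |x|) := by
        refine integral_mono_of_nonneg (Eventually.of_forall fun x =>
          mul_nonneg (gaussianPDFReal_nonneg _ _ _) (Real.exp_pos _).le) (hint.const_mul _)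
          (Eventually.of_forall fun x => ?_)
        refine mul_le_mul_of_nonneg_right ?_ (Real.exp_pos _).le
        rw [gaussianPDFReal]
        refine (mul_le_of_le_one_right (by positivity) (Real.exp_le_one_iff.2 ?_)).trans ?_
        · exact div_nonpos_of_nonpos_of_nonneg (by nlinarith [sq_nonneg (x - 0)]) (by simp)
        · rw [one_div]
          refine inv_anti₀ two_pos (Real.le_sqrt_of_sq_le ?_)
          push_cast
          nlinarith [Real.pi_gt_three]
    _ = 1 / l := by
        rw [integral_const_mul, hI]
        ring

/-- In the characteristic function, row `i` contributes `n` equal Gaussian factors because `σ_j² =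
1`; the normalization makes their product standard. -/
theorem map_mulVec_gaussianEntries {n : ℕ} (hn : 0 < n) {σ : Fin n → ℝ}
    (hσ : σ ∈ signVectors n) :
    (gaussianEntries n).map (fun x i => (√n)⁻¹ * (entriesMatrix x *ᵥ σ) i) =
      Measure.pi fun _ => gaussianReal 0 1 := by
  have hcont : Continuous fun (x : Fin n × Fin n → ℝ) (i : Fin n) =>
      (√n)⁻¹ * (entriesMatrix x *ᵥ σ) i :=
    continuous_pi fun i => continuous_const.mul
      ((continuous_apply i).comp (continuous_entriesMatrix_mulVec σ))
  have : IsFiniteMeasure ((gaussianEntries n).map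
      fun x i => (√n)⁻¹ * (entriesMatrix x *ᵥ σ) i) := inferInstance
  refine charFun_eq_pi_iff.1 fun t => ?_
  let T : EuclideanSpace ℝ (Fin n × Fin n) := WithLp.toLp 2 fun p => (√n)⁻¹ * (t p.1 * σ p.2)
  have h1 : charFun (((gaussianEntries n).map
      fun x i => (√n)⁻¹ * (entriesMatrix x *ᵥ σ) i).map (WithLp.toLp 2)) t =
      charFun ((gaussianEntries n).map (WithLp.toLp 2)) T := by
    rw [charFun_apply, charFun_apply, integral_map (by fun_prop) (by fun_prop),
      integral_map hcont.aemeasurable (by fun_prop), integral_map (by fun_prop) (by fun_prop)]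
    congr 1
    funext x
    congr 3
    simp only [PiLp.inner_apply, T]
    rw [Fintype.sum_prod_type]
    refine Finset.sum_congr rfl fun i _ => ?_
    simp only [entriesMatrix, Matrix.mulVec, dotProduct, Matrix.of_apply]
    simp only [RCLike.inner_apply, conj_trivial, Finset.mul_sum]
    refine Finset.sum_congr rfl fun j _ => ?_
    ring
  rw [h1, gaussianEntries, charFun_pi, Fintype.prod_prod_type]
  refine Finset.prod_congr rfl fun i _ => ?_
  simp only [charFun_gaussianReal, T]
  rw [← Complex.exp_sum]
  congr 1
  have hn0 : (0 : ℝ) < n := by exact_mod_cast hn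
  have h2 (j : Fin n) : ((√n)⁻¹ * (t i * σ j)) ^ 2 = (n : ℝ)⁻¹ * t i ^ 2 := by
    rw [mul_pow, mul_pow, inv_pow, Real.sq_sqrt hn0.le, ← sq_abs (σ j),
      abs_eq_one_of_mem_signVectors hσ]
    ring
  have h3 (j : Fin n) : ((((√n)⁻¹ * (t i * σ j) : ℝ)) : ℂ) ^ 2 = (n : ℂ)⁻¹ * (t i : ℂ) ^ 2 := by
    rw [← Complex.ofReal_pow, h2]
    push_cast
    rfl
  have hnc : (n : ℂ) ≠ 0 := by exact_mod_cast hn.ne'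
  simp only [h3]
  simp
  field_simp

theorem rpow_mul_sum_abs_le_norm_toLp {n : ℕ} (hn : 0 < n) {q : ℝ≥0∞} (hq : 2 ≤ q)
    (y : Fin n → ℝ) :
    (n : ℝ) ^ ((q⁻¹).toReal - 1) * ∑ i, |y i| ≤
      ‖(WithLp.toLp q y : PiLp q fun _ : Fin n => ℝ)‖ := by
  have hn0 : (0 : ℝ) < n := by exact_mod_cast hn
  suffices h : ∑ i, |y i| ≤
      ‖(WithLp.toLp q y : PiLp q fun _ : Fin n => ℝ)‖ * (n : ℝ) ^ (1 - (q⁻¹).toReal) by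
    rw [← neg_sub, Real.rpow_neg hn0.le, inv_mul_le_iff₀ (Real.rpow_pos_of_pos hn0 _)]
    linarith
  rcases eq_or_ne q ⊤ with rfl | hqt
  · rw [PiLp.norm_toLp]
    refine (Finset.sum_le_card_nsmul _ _ ‖y‖ fun i _ => by
      simpa using norm_le_pi_norm y i).trans (le_of_eq ?_)
    simp [mul_comm]
  · have hp : 2 ≤ q.toReal := by simpa using ENNReal.toReal_mono hqt hq
    have hp0 : 0 < q.toReal := by linarith
    have h := Real.inner_le_Lp_mul_Lq Finset.univ (fun i => |y i|) (fun _ => (1 : ℝ))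
      (Real.HolderConjugate.conjExponent (p := q.toReal) (by linarith))
    rw [PiLp.norm_eq_sum hp0, ENNReal.toReal_inv]
    have e : 1 / q.toReal.conjExponent = 1 - q.toReal⁻¹ := by
      rw [Real.conjExponent, one_div_div]
      field_simp
    rw [e] at h
    simpa using h

section mean

variable {n : ℕ} {q : ℝ≥0∞}

theorem integral_exp_neg_sum_abs_le (hn : 0 < n) {σ : Fin n → ℝ} (hσ : σ ∈ signVectors n) {l : ℝ}
    (hl : 0 < l) :
    ∫ x, Real.exp (-l * ∑ i, |(√n)⁻¹ * (entriesMatrix x *ᵥ σ) i|) ∂gaussianEntries n ≤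
      (1 / l) ^ n := by
  have hcont : Continuous fun (x : Fin n × Fin n → ℝ) (i : Fin n) =>
      (√n)⁻¹ * (entriesMatrix x *ᵥ σ) i :=
    continuous_pi fun i => continuous_const.mul
      ((continuous_apply i).comp (continuous_entriesMatrix_mulVec σ))
  have h := integral_map (μ := gaussianEntries n) hcont.aemeasurable
    (f := fun y : Fin n → ℝ => Real.exp (-l * ∑ i, |y i|))
    (Continuous.aestronglyMeasurable (by fun_prop))
  rw [← h, map_mulVec_gaussianEntries hn hσ]
  simp only [Finset.mul_sum, Real.exp_sum]
  rw [integral_fintype_prod_eq_prod (fun _ x => Real.exp (-l * |x|))]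
  refine (Finset.prod_le_prod (fun i _ => integral_nonneg fun x => (Real.exp_pos _).le)
    fun i _ => integral_exp_neg_mul_abs_gaussianReal_le hl).trans (le_of_eq ?_)
  simp

theorem card_signVectors (n : ℕ) : (signVectors n).card = 2 ^ n := by
  have : ({-1, 1} : Finset ℝ).card = 2 := Finset.card_pair (by norm_num)
  simp [signVectors, Fintype.card_piFinset, this]

theorem le_integral_lqDisc (hn : 0 < n) (hq : 2 ≤ q) :
    (n : ℝ) ^ ((q⁻¹).toReal + 1 / 2) / (2 * Real.exp 1) ≤
      ∫ x, lqDisc q (entriesMatrix x) ∂gaussianEntries n := by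
  have hn0 : (0 : ℝ) < n := by exact_mod_cast hn
  -- Chosen so that `e^n · 2^n · (1/l)^n = 1` in the sum over sign vectors.
  set l := 2 * Real.exp 1 with hl
  have hl0 : 0 < l := by positivity
  set W : (Fin n → ℝ) → (Fin n × Fin n → ℝ) → ℝ := fun σ x =>
    ∑ i, |(√n)⁻¹ * (entriesMatrix x *ᵥ σ) i| with hW
  have hWcont (σ) : Continuous (W σ) := continuous_finsetSum _ fun i _ =>
    (continuous_const.mul ((continuous_apply i).comp (continuous_entriesMatrix_mulVec σ))).abs
  set c := (n : ℝ) ^ ((q⁻¹).toReal - 1) * √n with hc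
  have hc0 : 0 < c := by positivity
  have hint (σ) : Integrable (fun x => Real.exp (-l * W σ x)) (gaussianEntries n) := by
    refine Integrable.of_bound (Continuous.aestronglyMeasurable
      (Real.continuous_exp.comp (continuous_const.mul (hWcont σ)))) 1
      (Eventually.of_forall fun x => ?_)
    rw [Real.norm_of_nonneg (Real.exp_pos _).le, Real.exp_le_one_iff, neg_mul, neg_nonpos]
    exact mul_nonneg hl0.le (Finset.sum_nonneg fun _ _ => abs_nonneg _)
  -- A union bound in expectation: `e^s ≥ 1 + s` at `s = n - lW` bounds `lW` from below, and
  -- replacing one exponential by the sum makes the bound uniform in `σ`.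
  have hpt (x : Fin n × Fin n → ℝ) :
      c / l * (n + 1 - Real.exp n * ∑ σ ∈ signVectors n, Real.exp (-l * W σ x)) ≤
        lqDisc q (entriesMatrix x) := by
    refine Finset.le_inf' _ _ fun σ hσ => ?_
    refine le_trans ?_ (rpow_mul_sum_abs_le_norm_toLp hn hq _)
    have h1 : (n : ℝ) ^ ((q⁻¹).toReal - 1) * ∑ i, |(entriesMatrix x *ᵥ σ) i| = c * W σ x := by
      simp only [hW, hc, abs_mul, ← Finset.mul_sum]
      rw [abs_of_nonneg (by positivity)]
      field_simp
    rw [h1, div_mul_eq_mul_div, div_le_iff₀ hl0, mul_assoc c (W σ x) l]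
    refine mul_le_mul_of_nonneg_left ?_ hc0.le
    have h2 := Finset.single_le_sum (f := fun σ => Real.exp (-l * W σ x))
      (fun _ _ => (Real.exp_pos _).le) hσ
    have h3 := mul_le_mul_of_nonneg_left h2 (Real.exp_pos n).le
    have h4 := Real.add_one_le_exp (n + -l * W σ x)
    rw [Real.exp_add] at h4
    linarith
  have hsum : Integrable (fun x => ∑ σ ∈ signVectors n, Real.exp (-l * W σ x))
      (gaussianEntries n) := integrable_finsetSum _ fun σ _ => hint σ
  have hsumle : Real.exp n * ∫ x, ∑ σ ∈ signVectors n, Real.exp (-l * W σ x) ∂gaussianEntries n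
      ≤ 1 := by
    rw [integral_finsetSum _ fun σ _ => hint σ]
    have h1 := Finset.sum_le_card_nsmul (signVectors n)
      (fun σ => ∫ x, Real.exp (-l * W σ x) ∂gaussianEntries n) ((1 / l) ^ n)
      fun σ hσ => integral_exp_neg_sum_abs_le hn hσ hl0
    refine (mul_le_mul_of_nonneg_left h1 (Real.exp_pos n).le).trans (le_of_eq ?_)
    have h2 : Real.exp n = Real.exp 1 ^ n := by rw [← Real.exp_nat_mul, mul_one]
    rw [card_signVectors, nsmul_eq_mul, h2]
    push_cast
    rw [← mul_pow, ← mul_pow, hl]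
    have : Real.exp 1 * (2 * (1 / (2 * Real.exp 1))) = 1 := by
      have := Real.exp_pos 1
      field_simp
    rw [this, one_pow]
  have hmono := integral_mono (μ := gaussianEntries n)
    (((integrable_const ((n : ℝ) + 1)).sub (hsum.const_mul (Real.exp n))).const_mul (c / l))
    ((memLp_lqDisc hn hq).integrable one_le_two) hpt
  refine le_trans ?_ hmono
  have hI : ∫ x, c / l * ((n : ℝ) + 1 - Real.exp n *
      ∑ σ ∈ signVectors n, Real.exp (-l * W σ x)) ∂gaussianEntries n =
      c / l * (n + 1 - Real.exp n *
        ∫ x, ∑ σ ∈ signVectors n, Real.exp (-l * W σ x) ∂gaussianEntries n) := by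
    rw [integral_const_mul, integral_sub (integrable_const _) (hsum.const_mul _),
      integral_const_mul]
    simp
  have hcn : (n : ℝ) ^ ((q⁻¹).toReal + 1 / 2) = c * n := by
    rw [hc, Real.sqrt_eq_rpow, ← Real.rpow_add hn0, ← Real.rpow_add_one hn0.ne']
    congr 1
    ring
  rw [hcn]
  refine le_trans (le_of_eq (by ring : c * n / l = c / l * n)) ((mul_le_mul_of_nonneg_left ?_
    (by positivity : 0 ≤ c / l)).trans (le_of_eq hI.symm))
  linarith

/-! ### Positivity of the variance and the final ratio -/

instance : Measure.IsOpenPosMeasure (gaussianReal 0 1) :=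
  (gaussianReal_absolutelyContinuous' 0 one_ne_zero).isOpenPosMeasure

instance (n : ℕ) : Measure.IsOpenPosMeasure (gaussianEntries n) :=
  inferInstanceAs (Measure.IsOpenPosMeasure (Measure.pi _))

/-- With zero variance, continuity and full support would make the discrepancy equal to its mean
everywhere; it vanishes at the zero matrix, while the mean is positive. -/
theorem variance_lqDisc_pos (hn : 0 < n) (hq : 2 ≤ q) :
    0 < Var[fun x => lqDisc q (entriesMatrix x); gaussianEntries n] := by
  refine (variance_nonneg _ _).lt_of_ne fun h => ?_
  have hq1 : 1 ≤ q := one_le_two.trans hq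
  have : Fact (1 ≤ q) := ⟨hq1⟩
  have h1 := ae_eq_integral_of_variance_eq_zero (memLp_lqDisc hn hq) h.symm
  have h2 := congrFun (((continuous_lqDisc hq1).ae_eq_iff_eq (gaussianEntries n)
    continuous_const).1 h1) 0
  have h3 : lqDisc q (entriesMatrix (0 : Fin n × Fin n → ℝ)) = 0 := by
    have : (entriesMatrix (0 : Fin n × Fin n → ℝ)) = 0 := rfl
    simp [lqDisc, this]
  have h4 := le_integral_lqDisc hn hq
  have h5 : 0 < (n : ℝ) ^ ((q⁻¹).toReal + 1 / 2) / (2 * Real.exp 1) := by positivity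
  rw [h3] at h2
  linarith

theorem le_integral_div_sqrt_variance_lqDisc (hn : 0 < n) (hq : 2 ≤ q) :
    1 / (2 * Real.exp 1 * √8) *
        ((n : ℝ) ^ (q⁻¹).toReal * √(1 + (1 / 2 - (q⁻¹).toReal) * Real.log n)) ≤
      (∫ x, lqDisc q (entriesMatrix x) ∂gaussianEntries n) /
        √(Var[fun x => lqDisc q (entriesMatrix x); gaussianEntries n]) := by
  have hn0 : (0 : ℝ) < n := by exact_mod_cast hn
  set V := Var[fun x => lqDisc q (entriesMatrix x); gaussianEntries n] with hV
  have hV0 : 0 < V := variance_lqDisc_pos hn hq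
  have hq2 : (q⁻¹).toReal ≤ 1 / 2 := by
    have := ENNReal.toReal_mono (by simp) (ENNReal.inv_le_inv.2 hq)
    simpa using this
  set D := 1 + (1 / 2 - (q⁻¹).toReal) * Real.log n with hD
  have hD0 : 0 < D := by
    have : 0 ≤ (1 / 2 - (q⁻¹).toReal) * Real.log n :=
      mul_nonneg (by linarith) (Real.log_nonneg (by exact_mod_cast hn))
    linarith
  have hVD : D * V ≤ 8 * n := by
    have h := variance_lqDisc_le hn hq
    rw [← hV, ← hD] at h
    have := mul_le_mul_of_nonneg_left h hD0.le
    refine this.trans (le_of_eq ?_)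
    field_simp
    norm_num
  rw [le_div_iff₀ (Real.sqrt_pos.2 hV0)]
  refine le_trans ?_ (le_integral_lqDisc hn hq)
  have h1 : √D * √V ≤ √8 * √n := by
    rw [← Real.sqrt_mul hD0.le, ← Real.sqrt_mul (by norm_num)]
    exact Real.sqrt_le_sqrt hVD
  calc 1 / (2 * Real.exp 1 * √8) * ((n : ℝ) ^ (q⁻¹).toReal * √D) * √V
      = 1 / (2 * Real.exp 1 * √8) * (n : ℝ) ^ (q⁻¹).toReal * (√D * √V) := by ring
    _ ≤ 1 / (2 * Real.exp 1 * √8) * (n : ℝ) ^ (q⁻¹).toReal * (√8 * √n) :=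
        mul_le_mul_of_nonneg_left h1 (by positivity)
    _ = (n : ℝ) ^ ((q⁻¹).toReal + 1 / 2) / (2 * Real.exp 1) := by
        rw [Real.rpow_add hn0, ← Real.sqrt_eq_rpow]
        field_simp

end mean

theorem mainTheorem3 :
    ∃ c : ℝ, 0 < c ∧
      ∀ (N : ℕ), 1 ≤ N → ∀ (q : ℝ≥0∞), 2 ≤ q →
        ∀ (Ω : Type*) [MeasurableSpace Ω] (μ : Measure Ω) [IsProbabilityMeasure μ]
          (A : Ω → Matrix (Fin N) (Fin N) ℝ), IsGaussianMatrix A μ →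
          MemLp (fun ω => lqDisc q (A ω)) 2 μ ∧
          0 < variance (fun ω => lqDisc q (A ω)) μ ∧
          c * ((N : ℝ) ^ (q⁻¹).toReal * √(1 + (1 / 2 - (q⁻¹).toReal) * Real.log N)) ≤
            (∫ ω, lqDisc q (A ω) ∂μ) / √(variance (fun ω => lqDisc q (A ω)) μ) := by
  refine ⟨1 / (2 * Real.exp 1 * √8), by positivity, fun N hN q hq Ω _ μ _ A hA => ?_⟩
  have hq1 : 1 ≤ q := one_le_two.trans hq
  have hlaw : HasLaw (fun ω (p : Fin N × Fin N) => A ω p.1 p.2) (gaussianEntries N) μ :=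
    iIndepFun.hasLaw_pi (fun p => hA.2 p.1 p.2) hA.1
  have hmeas : AEStronglyMeasurable (fun x => lqDisc q (entriesMatrix x))
      (μ.map fun ω (p : Fin N × Fin N) => A ω p.1 p.2) :=
    (continuous_lqDisc hq1).aestronglyMeasurable
  have hmem := memLp_lqDisc (n := N) hN hq
  have hmean := hlaw.integral_comp (f := fun x => lqDisc q (entriesMatrix x))
    (continuous_lqDisc hq1).aestronglyMeasurable
  have hvar : Var[fun ω => lqDisc q (A ω); μ] =
      Var[fun x => lqDisc q (entriesMatrix x); gaussianEntries N] := by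
    rw [← hlaw.map_eq, variance_map hmeas.aemeasurable hlaw.aemeasurable]
    rfl
  rw [← hlaw.map_eq, memLp_map_measure_iff hmeas hlaw.aemeasurable] at hmem
  refine ⟨hmem, hvar ▸ variance_lqDisc_pos hN hq, ?_⟩
  have h := le_integral_div_sqrt_variance_lqDisc (n := N) hN hq
  rw [← hmean, ← hvar] at h
  exact h
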